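/- Let $F$ be Thompson's group of orientation-preserving piecewise linear homeomorphisms of $[0,1]$ with finitely many breakpoints, all at dyadic rationals, and with slopes that are powers of $2$. Let $T$ be the group of orientation-preserving piecewise linear homeomorphisms of the circle $\mathbb{R}/\mathbb{Z}$ (the interval $[0,1]$ with its endpoints identified) that preserve the set of dyadic points, with finitely many breakpoints, all at dyadic points, and with slopes that are powers of $2$. In both groups the product is composition, $(vu)(t)=v(u(t))$. Let $\iota:F\to T$ be the inclusion that regards a homeomorphism of $[0,1]$ as a homeomorphism of the circle. Let $x_0,x_1\in F$ and $c_1\in T$ be given by $$x_0(t)=\begin{cases}\tfrac t2&0\le t\le\frac12\\ t-\tfrac14&\frac12\le t\le\frac34\\ 2t-1&\frac34\le t\le1\end{cases}\qquad x_1(t)=\begin{cases}t&0\le t\le\frac12\\ \tfrac t2+\tfrac14&\frac12\le t\le\frac34\\ t-\tfrac18&\frac34\le t\le\frac78\\ 2t-1&\frac78\le t\le1\end{cases}\qquad c_1(t)=\begin{cases}\tfrac t2+\tfrac34&0\le t<\frac12\\ 2t-1&\frac12\le t<\frac34\\ t-\tfrac14&\frac34\le t<1\end{cases}$$ (the values of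 $c_1$ being taken modulo $1$). For a finite generating set $S$ of a group $G$, let $d_S(g,h)$ be the word metric: the least length of a word in the elements of $S$ and their inverses that represents $g^{-1}h$. Then $\{x_0,x_1\}$ generates $F$, $\{\iota(x_0),\iota(x_1),c_1\}$ generates $T$, and $\iota$ is a quasi-isometric embedding with respect to the word metrics of these generating sets; moreover, it is a quasi-isometric embedding with respect to the word metrics of any finite generating sets. That is, for all finite generating sets $A$ of $F$ and $B$ of $T$ (in particular for $A=\{x_0,x_1\}$ and $B=\{\iota(x_0),\iota(x_1),c_1\}$) there are constants $K>0$ and $C$ such that for all $w,z\in F$ $$\frac1K\,d_A(w,z)-C\;\le\; d_B(\iota(w),\iota(z))\;\le\; K\,d_A(w,z)+C .$$ -/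

import Mathlib

open Topology

noncomputable section

namespace Thompson

/-! ## Word metrics and quasi-isometric embeddings -/

/-- The word length of `g` with respect to `S`: the least length of a word in the letters
`s`, `s⁻¹` (`s ∈ S`) with value `g`. (Only used when `S` generates the group, so that such a word
exists.) -/
def wordLength {G : Type*} [Group G] (S : Set G) (g : G) : ℕ :=
  sInf {n : ℕ | ∃ l : List G, (∀ a ∈ l, a ∈ S ∨ a⁻¹ ∈ S) ∧ l.prod = g ∧ l.length = n}

/-- The (left-invariant) word metric with respect to `S`. -/
def wordDist {G : Type*} [Group G] (S : Set G) (g h : G) : ℝ :=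
  (wordLength S (g⁻¹ * h) : ℝ)

/-- `f` is a quasi-isometric embedding for the distance functions `dX` and `dY`. -/
def IsQuasiIsometricEmbedding {X Y : Type*} (dX : X → X → ℝ) (dY : Y → Y → ℝ) (f : X → Y) : Prop :=
  ∃ K : ℝ, 0 < K ∧ ∃ C : ℝ, ∀ w z : X,
    (1 / K) * dX w z - C ≤ dY (f w) (f z) ∧ dY (f w) (f z) ≤ K * dX w z + C

/-! ## Dyadic rationals -/

/-- The real number `x` is a dyadic rational. -/
def IsDyadic (x : ℝ) : Prop := ∃ (m : ℤ) (n : ℕ), x = m / 2 ^ n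

/-- A point of the circle `ℝ / ℤ` is dyadic if it is the image of a dyadic rational. -/
def IsDyadicPt (x : UnitAddCircle) : Prop := ∃ t : ℝ, IsDyadic t ∧ (t : UnitAddCircle) = x

theorem IsDyadic.intCast (m : ℤ) : IsDyadic (m : ℝ) := ⟨m, 0, by simp⟩

theorem IsDyadic.add {x y : ℝ} (hx : IsDyadic x) (hy : IsDyadic y) : IsDyadic (x + y) := by
  obtain ⟨m, n, rfl⟩ := hx
  obtain ⟨m', n', rfl⟩ := hy
  refine ⟨m * 2 ^ n' + m' * 2 ^ n, n + n', ?_⟩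
  push_cast
  field_simp
  ring

theorem IsDyadic.mul {x y : ℝ} (hx : IsDyadic x) (hy : IsDyadic y) : IsDyadic (x * y) := by
  obtain ⟨m, n, rfl⟩ := hx
  obtain ⟨m', n', rfl⟩ := hy
  refine ⟨m * m', n + n', ?_⟩
  push_cast
  field_simp
  ring

theorem isDyadic_half : IsDyadic (1 / 2) := ⟨1, 1, by norm_num⟩

theorem isDyadic_quarter : IsDyadic (1 / 4) := ⟨1, 2, by norm_num⟩

theorem isDyadic_eighth : IsDyadic (1 / 8) := ⟨1, 3, by norm_num⟩

theorem isDyadicPt_coe {t : ℝ} : IsDyadicPt (t : UnitAddCircle) ↔ IsDyadic t := by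
  constructor
  · rintro ⟨s, hs, hst⟩
    rw [← sub_eq_zero, ← AddCircle.coe_sub, AddCircle.coe_eq_zero_iff] at hst
    obtain ⟨n, hn⟩ := hst
    have : t = s + ((-n : ℤ) : ℝ) := by
      push_cast
      simp only [zsmul_eq_mul, mul_one] at hn
      linarith
    rw [this]
    exact hs.add (IsDyadic.intCast _)
  · exact fun h => ⟨t, h, rfl⟩

/-! ## Thompson's group `F` -/

/-- The homeomorphism `f` of `[0, 1]` is piecewise linear, with finitely many breakpoints, all of
them at dyadic rationals, with slopes that are powers of two, and it preserves the set of dyadic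
rationals (so both coordinates of each breakpoint are dyadic). -/
def IsDyadicPLInterval (f : unitInterval ≃ₜ unitInterval) : Prop :=
  (∀ t : unitInterval, IsDyadic (f t : ℝ) ↔ IsDyadic (t : ℝ)) ∧
  ∃ S : Set unitInterval, S.Finite ∧ (∀ t ∈ S, IsDyadic (t : ℝ)) ∧
    ∀ t, t ∉ S → ∃ k : ℤ, ∀ᶠ s : unitInterval in 𝓝 t,
      (f s : ℝ) = (f t : ℝ) + (2 : ℝ) ^ k * ((s : ℝ) - (t : ℝ))

/-- Thompson's group `F`: the orientation-preserving piecewise linear homeomorphisms of `[0, 1]`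
with dyadic breakpoints and slopes that are powers of two. The product is composition:
`(v * u) t = v (u t)`. -/
def F : Subgroup (unitInterval ≃ₜ unitInterval) where
  carrier := {f | StrictMono f ∧ IsDyadicPLInterval f}
  one_mem' := by
    refine ⟨fun _ _ h => h, fun t => Iff.rfl, ∅, Set.finite_empty, by simp, fun t _ => ⟨0, ?_⟩⟩
    refine Filter.Eventually.of_forall fun s => ?_
    change (s : ℝ) = t + _
    simp
  mul_mem' := by
    rintro f g ⟨hf, hfd, S, hS, hSd, hfS⟩ ⟨hg, hgd, R, hR, hRd, hgR⟩
    refine ⟨fun _ _ h => hf (hg h), fun t => (hfd _).trans (hgd t), R ∪ g ⁻¹' S,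
      hR.union (hS.preimage g.injective.injOn), ?_, ?_⟩
    · rintro t (ht | ht)
      · exact hRd t ht
      · exact (hgd t).1 (hSd _ ht)
    · intro t ht
      rw [Set.mem_union, not_or] at ht
      obtain ⟨k, hk⟩ := hgR t ht.1
      obtain ⟨l, hl⟩ := hfS (g t) ht.2
      refine ⟨l + k, ?_⟩
      filter_upwards [hk, (g.continuous.tendsto t).eventually hl] with s h1 h2
      change ((f (g s) : unitInterval) : ℝ) = (f (g t) : ℝ) + _
      rw [h2, h1, zpow_add₀ two_ne_zero]
      ring
  inv_mem' := by
    rintro f ⟨hf, hfd, S, hS, hSd, hfS⟩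
    refine ⟨fun a b h => ?_, fun t => ?_, f.symm ⁻¹' S, hS.preimage f.symm.injective.injOn, ?_, ?_⟩
    · change f.symm a < f.symm b
      rw [← hf.lt_iff_lt]
      simpa using h
    · change IsDyadic (f.symm t : ℝ) ↔ _
      rw [← hfd, f.apply_symm_apply]
    · intro t ht
      rw [← f.apply_symm_apply t]
      exact (hfd _).2 (hSd _ ht)
    · intro t ht
      obtain ⟨k, hk⟩ := hfS (f.symm t) ht
      refine ⟨-k, ?_⟩
      filter_upwards [(f.symm.continuous.tendsto t).eventually hk] with s h1
      change (f.symm s : ℝ) = (f.symm t : ℝ) + _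
      rw [f.apply_symm_apply, f.apply_symm_apply] at h1
      rw [h1, zpow_neg]
      field_simp
      ring

/-! ## Thompson's group `T` -/

/-- The homeomorphism `f` of the circle `ℝ / ℤ` preserves the orientation: it lifts to an increasing
bijection of the line that commutes with the translation by `1`. -/
def IsOrientationPreserving (f : UnitAddCircle ≃ₜ UnitAddCircle) : Prop :=
  ∃ φ : ℝ ≃o ℝ, (∀ x : ℝ, φ (x + 1) = φ x + 1) ∧ ∀ x : ℝ, f (x : UnitAddCircle) = (φ x : ℝ)

/-- The homeomorphism `f` of the circle `ℝ / ℤ` is piecewise linear, with finitely many breakpoints,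
all of them at dyadic points, with slopes that are powers of two, and it preserves the set of dyadic
points. -/
def IsDyadicPLCircle (f : UnitAddCircle ≃ₜ UnitAddCircle) : Prop :=
  (∀ x : UnitAddCircle, IsDyadicPt (f x) ↔ IsDyadicPt x) ∧
  ∃ S : Set UnitAddCircle, S.Finite ∧ (∀ x ∈ S, IsDyadicPt x) ∧
    ∀ x, x ∉ S → ∃ k : ℤ, ∀ᶠ h : ℝ in 𝓝 0,
      f (x + (h : UnitAddCircle)) = f x + (((2 : ℝ) ^ k * h : ℝ) : UnitAddCircle)

/-- Thompson's group `T`: the orientation-preserving piecewise linear homeomorphisms of the circle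
`ℝ / ℤ` (the interval `[0, 1]` with its endpoints identified) that preserve the dyadic points, with
dyadic breakpoints and slopes that are powers of two. The product is composition. -/
def T : Subgroup (UnitAddCircle ≃ₜ UnitAddCircle) where
  carrier := {f | IsOrientationPreserving f ∧ IsDyadicPLCircle f}
  one_mem' := by
    refine ⟨⟨OrderIso.refl ℝ, fun _ => rfl, fun _ => rfl⟩, fun t => Iff.rfl, ∅, Set.finite_empty,
      by simp, fun t _ => ⟨0, ?_⟩⟩
    refine Filter.Eventually.of_forall fun s => ?_
    change t + (s : UnitAddCircle) = t + _
    simp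
  mul_mem' := by
    rintro f g ⟨⟨φ, hφ, hφf⟩, hfd, S, hS, hSd, hfS⟩ ⟨⟨ψ, hψ, hψg⟩, hgd, R, hR, hRd, hgR⟩
    refine ⟨⟨ψ.trans φ, fun x => ?_, fun x => ?_⟩, fun t => (hfd _).trans (hgd t), R ∪ g ⁻¹' S,
      hR.union (hS.preimage g.injective.injOn), ?_, ?_⟩
    · change φ (ψ (x + 1)) = φ (ψ x) + 1
      rw [hψ, hφ]
    · change f (g x) = (φ (ψ x) : ℝ)
      rw [hψg, hφf]
    · rintro t (ht | ht)
      · exact hRd t ht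
      · exact (hgd t).1 (hSd _ ht)
    · intro t ht
      rw [Set.mem_union, not_or] at ht
      obtain ⟨k, hk⟩ := hgR t ht.1
      obtain ⟨l, hl⟩ := hfS (g t) ht.2
      refine ⟨l + k, ?_⟩
      have hlim : Filter.Tendsto (fun h : ℝ => (2 : ℝ) ^ k * h) (𝓝 0) (𝓝 0) := by
        have : Continuous fun h : ℝ => (2 : ℝ) ^ k * h := by fun_prop
        simpa using this.tendsto 0
      filter_upwards [hk, hlim.eventually hl] with h h1 h2
      change f (g (t + (h : UnitAddCircle))) = f (g t) + _
      rw [h1, h2, zpow_add₀ two_ne_zero, mul_assoc]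
  inv_mem' := by
    rintro f ⟨⟨φ, hφ, hφf⟩, hfd, S, hS, hSd, hfS⟩
    refine ⟨⟨φ.symm, fun x => ?_, fun x => ?_⟩, fun t => ?_, f.symm ⁻¹' S,
      hS.preimage f.symm.injective.injOn, ?_, ?_⟩
    · apply φ.injective
      rw [hφ, φ.apply_symm_apply, φ.apply_symm_apply]
    · change f.symm x = _
      rw [Homeomorph.symm_apply_eq, hφf, φ.apply_symm_apply]
    · change IsDyadicPt (f.symm t) ↔ _
      rw [← hfd, f.apply_symm_apply]
    · intro t ht
      rw [← f.apply_symm_apply t]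
      exact (hfd _).2 (hSd _ ht)
    · intro t ht
      obtain ⟨k, hk⟩ := hfS (f.symm t) ht
      refine ⟨-k, ?_⟩
      have hlim : Filter.Tendsto (fun h : ℝ => (2 : ℝ) ^ (-k) * h) (𝓝 0) (𝓝 0) := by
        have : Continuous fun h : ℝ => (2 : ℝ) ^ (-k) * h := by fun_prop
        simpa using this.tendsto 0
      filter_upwards [hlim.eventually hk] with h h1
      change f.symm (t + (h : UnitAddCircle)) = f.symm t + _
      rw [f.apply_symm_apply, ← mul_assoc, ← zpow_add₀ two_ne_zero, add_neg_cancel, zpow_zero,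
        one_mul] at h1
      rw [← h1, f.symm_apply_apply]

/-! ## The inclusion of `F` in `T` -/

/-- The self-map of the circle induced by a self-map `f` of `[0, 1]`: it sends the class of
`t ∈ [0, 1)` to the class of `f t`. -/
def circleFun (f : unitInterval → unitInterval) : UnitAddCircle → UnitAddCircle :=
  AddCircle.liftIco 1 0 fun t : ℝ =>
    ((f (Set.projIcc 0 1 zero_le_one t) : ℝ) : UnitAddCircle)

theorem F_map_zero (f : F) : f.1 0 = 0 := by
  obtain ⟨t, ht⟩ := f.1.surjective 0
  have := f.2.1.monotone (show (0 : unitInterval) ≤ t from t.2.1)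
  rw [ht] at this
  exact le_antisymm this (f.1 0).2.1

theorem F_map_one (f : F) : f.1 1 = 1 := by
  obtain ⟨t, ht⟩ := f.1.surjective 1
  have := f.2.1.monotone (show t ≤ (1 : unitInterval) from t.2.2)
  rw [ht] at this
  exact le_antisymm (f.1 1).2.2 this

theorem circleFun_coe (f : F) (t : unitInterval) :
    circleFun f.1 ((t : ℝ) : UnitAddCircle) = ((f.1 t : ℝ) : UnitAddCircle) := by
  rcases eq_or_ne t 1 with rfl | h
  · have h0 : (((1 : unitInterval) : ℝ) : UnitAddCircle) = ((0 : ℝ) : UnitAddCircle) := by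
      rw [AddCircle.coe_zero]
      exact AddCircle.coe_period 1
    rw [F_map_one, h0, circleFun, AddCircle.liftIco_zero_coe_apply (by norm_num),
      Set.projIcc_left]
    have := F_map_zero f
    change (((f.1 0 : unitInterval) : ℝ) : UnitAddCircle) = _
    rw [this]
    rfl
  · have h1 : (t : ℝ) < 1 := lt_of_le_of_ne t.2.2 fun h' => h (Subtype.ext h')
    rw [circleFun, AddCircle.liftIco_zero_coe_apply ⟨t.2.1, h1⟩, Set.projIcc_val]

theorem exists_coe_eq (x : UnitAddCircle) :
    ∃ t : unitInterval, (t : ℝ) < 1 ∧ ((t : ℝ) : UnitAddCircle) = x := by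
  have : x ∈ ((↑) : ℝ → UnitAddCircle) '' Set.Ico 0 (0 + 1) := by
    rw [AddCircle.coe_image_Ico_eq]
    trivial
  obtain ⟨t, ht, rfl⟩ := this
  rw [zero_add] at ht
  exact ⟨⟨t, ht.1, ht.2.le⟩, ht.2, rfl⟩

theorem continuous_circleFun (f : F) : Continuous (circleFun f.1) := by
  refine AddCircle.liftIco_zero_continuous ?_ ?_
  · rw [Set.projIcc_left, Set.projIcc_right]
    change (((f.1 0 : unitInterval) : ℝ) : UnitAddCircle) = ((f.1 1 : unitInterval) : ℝ)
    rw [F_map_zero, F_map_one]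
    exact (AddCircle.coe_period 1).symm
  · have h1 : Continuous fun t : ℝ => (f.1 (Set.projIcc 0 1 zero_le_one t) : ℝ) :=
      continuous_subtype_val.comp (f.1.continuous.comp continuous_projIcc)
    exact ((AddCircle.continuous_mk' 1).comp h1).continuousOn

theorem circleFun_mul (f g : F) (x : UnitAddCircle) :
    circleFun f.1 (circleFun g.1 x) = circleFun (f * g).1 x := by
  obtain ⟨t, -, rfl⟩ := exists_coe_eq x
  rw [circleFun_coe, circleFun_coe, circleFun_coe]
  rfl

theorem circleFun_one (x : UnitAddCircle) : circleFun (1 : F).1 x = x := by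
  obtain ⟨t, -, rfl⟩ := exists_coe_eq x
  rw [circleFun_coe]
  rfl

/-- The homeomorphism of the circle induced by an element of `F`. -/
def circleHomeo (f : F) : UnitAddCircle ≃ₜ UnitAddCircle where
  toFun := circleFun f.1
  invFun := circleFun (f⁻¹).1
  left_inv x := by rw [circleFun_mul, inv_mul_cancel, circleFun_one]
  right_inv x := by rw [circleFun_mul, mul_inv_cancel, circleFun_one]
  continuous_toFun := continuous_circleFun f
  continuous_invFun := continuous_circleFun f⁻¹

theorem circleHomeo_coe (f : F) (t : unitInterval) :
    circleHomeo f ((t : ℝ) : UnitAddCircle) = ((f.1 t : ℝ) : UnitAddCircle) :=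
  circleFun_coe f t

/-- The fractional part, as a point of `[0, 1]`. -/
def fractI (x : ℝ) : unitInterval := ⟨Int.fract x, Int.fract_nonneg x, (Int.fract_lt_one x).le⟩

/-- The lift of `circleHomeo f` to the line. -/
def liftFun (f : F) (x : ℝ) : ℝ := ⌊x⌋ + (f.1 (fractI x) : ℝ)

theorem map_fractI_lt_one (f : F) (x : ℝ) : (f.1 (fractI x) : ℝ) < 1 := by
  have h : fractI x < 1 := Int.fract_lt_one x
  have := f.2.1 h
  rw [F_map_one] at this
  exact this

theorem floor_liftFun (f : F) (x : ℝ) : ⌊liftFun f x⌋ = ⌊x⌋ := by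
  rw [Int.floor_eq_iff]
  have h0 := (f.1 (fractI x)).2.1
  have h1 := map_fractI_lt_one f x
  unfold liftFun
  constructor <;> linarith

theorem fractI_liftFun (f : F) (x : ℝ) : fractI (liftFun f x) = f.1 (fractI x) := by
  apply Subtype.ext
  change Int.fract (liftFun f x) = _
  rw [Int.fract, floor_liftFun, liftFun]
  ring

theorem liftFun_liftFun (f g : F) (h : f * g = 1) (x : ℝ) : liftFun f (liftFun g x) = x := by
  have h1 : f.1 (g.1 (fractI x)) = fractI x := by
    change (f * g).1 (fractI x) = fractI x
    rw [h]
    rfl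
  rw [liftFun, floor_liftFun, fractI_liftFun, h1]
  exact Int.floor_add_fract x

theorem strictMono_liftFun (f : F) : StrictMono (liftFun f) := by
  intro x y hxy
  rcases (Int.floor_mono hxy.le).lt_or_eq with h | h
  · have h0 := (f.1 (fractI y)).2.1
    have h1 := map_fractI_lt_one f x
    have h2 : (⌊x⌋ : ℝ) + 1 ≤ ⌊y⌋ := by exact_mod_cast h
    unfold liftFun
    linarith
  · have hf : fractI x < fractI y := by
      change Int.fract x < Int.fract y
      rw [Int.fract, Int.fract, h]
      linarith
    have : (f.1 (fractI x) : ℝ) < f.1 (fractI y) := f.2.1 hf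
    rw [liftFun, liftFun, h]
    linarith

/-- The lift of `circleHomeo f` to the line, as an increasing bijection. -/
def liftIso (f : F) : ℝ ≃o ℝ :=
  (strictMono_liftFun f).orderIsoOfRightInverse (liftFun f) (liftFun f⁻¹)
    (liftFun_liftFun f f⁻¹ (mul_inv_cancel f))

theorem coe_fractI (x : ℝ) : ((fractI x : ℝ) : UnitAddCircle) = (x : UnitAddCircle) := by
  have h : (x : UnitAddCircle) - ((fractI x : ℝ) : UnitAddCircle) = 0 := by
    rw [← AddCircle.coe_sub, AddCircle.coe_eq_zero_iff]
    refine ⟨⌊x⌋, ?_⟩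
    change _ = x - Int.fract x
    rw [Int.fract]
    simp
  exact (sub_eq_zero.1 h).symm

theorem coe_intCast_add (m : ℤ) (x : ℝ) : (((m : ℝ) + x : ℝ) : UnitAddCircle) = x := by
  have h : (((m : ℝ) + x : ℝ) : UnitAddCircle) - (x : UnitAddCircle) = 0 := by
    rw [← AddCircle.coe_sub, AddCircle.coe_eq_zero_iff]
    exact ⟨m, by simp⟩
  exact sub_eq_zero.1 h

theorem circleHomeo_mem_T (f : F) : circleHomeo f ∈ T := by
  obtain ⟨hf, hfd, S, hS, hSd, hfS⟩ := f.2
  refine ⟨⟨liftIso f, fun x => ?_, fun x => ?_⟩, fun x => ?_,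
    (fun t : unitInterval => ((t : ℝ) : UnitAddCircle)) '' (S ∪ {0}),
    (hS.union (Set.finite_singleton 0)).image _, ?_, ?_⟩
  · change liftFun f (x + 1) = liftFun f x + 1
    have h : fractI (x + 1) = fractI x := Subtype.ext (Int.fract_add_one x)
    rw [liftFun, liftFun, h, Int.floor_add_one]
    push_cast
    ring
  · change _ = (liftFun f x : UnitAddCircle)
    rw [← coe_fractI, circleHomeo_coe, liftFun, coe_intCast_add]
  · obtain ⟨t, -, rfl⟩ := exists_coe_eq x
    rw [circleHomeo_coe, isDyadicPt_coe, isDyadicPt_coe]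
    exact hfd t
  · rintro _ ⟨t, ht, rfl⟩
    refine isDyadicPt_coe.2 ?_
    rcases ht with ht | rfl
    · exact hSd t ht
    · simpa using IsDyadic.intCast 0
  · intro x hx
    obtain ⟨t, ht1, rfl⟩ := exists_coe_eq x
    have htS : t ∉ S ∪ {0} := fun h => hx ⟨t, h, rfl⟩
    rw [Set.mem_union, not_or] at htS
    have ht0 : 0 < (t : ℝ) := lt_of_le_of_ne t.2.1 fun h => htS.2 (Subtype.ext h.symm)
    obtain ⟨k, hk⟩ := hfS t htS.1
    refine ⟨k, ?_⟩
    have hlim : Filter.Tendsto (fun h : ℝ => Set.projIcc (0 : ℝ) 1 zero_le_one (t + h)) (𝓝 0)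
        (𝓝 t) := by
      have h1 : Continuous fun h : ℝ => Set.projIcc (0 : ℝ) 1 zero_le_one (t + h) :=
        continuous_projIcc.comp (by fun_prop)
      have h2 := h1.tendsto 0
      rwa [add_zero, Set.projIcc_val] at h2
    filter_upwards [hlim.eventually hk, lt_mem_nhds (show -(t : ℝ) < 0 by linarith),
      gt_mem_nhds (show (0 : ℝ) < 1 - t by linarith)] with h h1 h2 h3
    have hmem : (t : ℝ) + h ∈ Set.Icc (0 : ℝ) 1 := ⟨by linarith, by linarith⟩
    rw [Set.projIcc_of_mem zero_le_one hmem] at h1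
    rw [← AddCircle.coe_add, circleHomeo_coe, ← AddCircle.coe_add]
    have h4 := circleHomeo_coe f ⟨(t : ℝ) + h, hmem⟩
    rw [h1] at h4
    simpa using h4

/-- The inclusion of `F` in `T`: a homeomorphism of `[0, 1]` is viewed as a homeomorphism of the
circle obtained from `[0, 1]` by identifying the endpoints. -/
def inclusion : F →* T where
  toFun f := ⟨circleHomeo f, circleHomeo_mem_T f⟩
  map_one' := Subtype.ext (Homeomorph.ext circleFun_one)
  map_mul' f g := Subtype.ext (Homeomorph.ext fun x => (circleFun_mul f g x).symm)

theorem inclusion_apply (f : F) (t : unitInterval) :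
    (inclusion f).1 ((t : ℝ) : UnitAddCircle) = ((f.1 t : ℝ) : UnitAddCircle) :=
  circleHomeo_coe f t

/-! ## The generators -/

/-- A homeomorphism of `[0, 1]` from two functions that are inverse to each other on `[0, 1]`. -/
def mkHomeo (f g : ℝ → ℝ) (hf : Continuous f) (hg : Continuous g)
    (hfm : ∀ t ∈ Set.Icc (0 : ℝ) 1, f t ∈ Set.Icc (0 : ℝ) 1)
    (hgm : ∀ t ∈ Set.Icc (0 : ℝ) 1, g t ∈ Set.Icc (0 : ℝ) 1)
    (hgf : ∀ t ∈ Set.Icc (0 : ℝ) 1, g (f t) = t) (hfg : ∀ t ∈ Set.Icc (0 : ℝ) 1, f (g t) = t) :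
    unitInterval ≃ₜ unitInterval where
  toFun t := ⟨f t, hfm t t.2⟩
  invFun t := ⟨g t, hgm t t.2⟩
  left_inv t := Subtype.ext (hgf t t.2)
  right_inv t := Subtype.ext (hfg t t.2)
  continuous_toFun := (hf.comp continuous_subtype_val).subtype_mk _
  continuous_invFun := (hg.comp continuous_subtype_val).subtype_mk _

/-- The formula for `x₀`. -/
def x₀Fun (t : ℝ) : ℝ :=
  if t ≤ 1 / 2 then t / 2 else if t ≤ 3 / 4 then t - 1 / 4 else 2 * t - 1

/-- The formula for the inverse of `x₀`. -/
def x₀Inv (t : ℝ) : ℝ :=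
  if t ≤ 1 / 4 then 2 * t else if t ≤ 1 / 2 then t + 1 / 4 else (t + 1) / 2

/-- The formula for `x₁`: the identity on `[0, 1/2]` and a rescaled copy of `x₀` on `[1/2, 1]`. -/
def x₁Fun (t : ℝ) : ℝ :=
  if t ≤ 1 / 2 then t else if t ≤ 3 / 4 then t / 2 + 1 / 4 else
    if t ≤ 7 / 8 then t - 1 / 8 else 2 * t - 1

/-- The formula for the inverse of `x₁`. -/
def x₁Inv (t : ℝ) : ℝ :=
  if t ≤ 1 / 2 then t else if t ≤ 5 / 8 then 2 * t - 1 / 2 else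
    if t ≤ 3 / 4 then t + 1 / 8 else (t + 1) / 2

theorem continuous_x₀Fun : Continuous x₀Fun := by
  unfold x₀Fun
  refine Continuous.if_le (by fun_prop) (Continuous.if_le (by fun_prop) (by fun_prop)
    continuous_id continuous_const ?_) continuous_id continuous_const ?_
  · intro t ht
    rw [ht]
    norm_num
  · intro t ht
    rw [ht]
    norm_num

theorem continuous_x₀Inv : Continuous x₀Inv := by
  unfold x₀Inv
  refine Continuous.if_le (by fun_prop) (Continuous.if_le (by fun_prop) (by fun_prop)
    continuous_id continuous_const ?_) continuous_id continuous_const ?_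
  · intro t ht
    rw [ht]
    norm_num
  · intro t ht
    rw [ht]
    norm_num

theorem continuous_x₁Fun : Continuous x₁Fun := by
  unfold x₁Fun
  refine Continuous.if_le (by fun_prop) (Continuous.if_le (by fun_prop) (Continuous.if_le
    (by fun_prop) (by fun_prop) continuous_id continuous_const ?_)
    continuous_id continuous_const ?_) continuous_id continuous_const ?_
  all_goals
    intro t ht
    rw [ht]
    norm_num

theorem continuous_x₁Inv : Continuous x₁Inv := by
  unfold x₁Inv
  refine Continuous.if_le (by fun_prop) (Continuous.if_le (by fun_prop) (Continuous.if_le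
    (by fun_prop) (by fun_prop) continuous_id continuous_const ?_)
    continuous_id continuous_const ?_) continuous_id continuous_const ?_
  all_goals
    intro t ht
    rw [ht]
    norm_num

/-- The homeomorphism `x₀` of `[0, 1]`. -/
def x₀Homeo : unitInterval ≃ₜ unitInterval :=
  mkHomeo x₀Fun x₀Inv continuous_x₀Fun continuous_x₀Inv
    (by rintro t ⟨h0, h1⟩; unfold x₀Fun; constructor <;> split_ifs <;> linarith)
    (by rintro t ⟨h0, h1⟩; unfold x₀Inv; constructor <;> split_ifs <;> linarith)
    (by rintro t ⟨h0, h1⟩; unfold x₀Fun x₀Inv; split_ifs <;> linarith)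
    (by rintro t ⟨h0, h1⟩; unfold x₀Fun x₀Inv; split_ifs <;> linarith)

/-- The homeomorphism `x₁` of `[0, 1]`. -/
def x₁Homeo : unitInterval ≃ₜ unitInterval :=
  mkHomeo x₁Fun x₁Inv continuous_x₁Fun continuous_x₁Inv
    (by rintro t ⟨h0, h1⟩; unfold x₁Fun; constructor <;> split_ifs <;> linarith)
    (by rintro t ⟨h0, h1⟩; unfold x₁Inv; constructor <;> split_ifs <;> linarith)
    (by rintro t ⟨h0, h1⟩; unfold x₁Fun x₁Inv; split_ifs <;> linarith)
    (by rintro t ⟨h0, h1⟩; unfold x₁Fun x₁Inv; split_ifs <;> linarith)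

theorem isDyadic_affine_iff (k : ℤ) (m : ℤ) (n : ℕ) (t : ℝ) :
    IsDyadic ((2 : ℝ) ^ k * t + m / 2 ^ n) ↔ IsDyadic t := by
  have hpow : ∀ k : ℤ, IsDyadic ((2 : ℝ) ^ k) := by
    intro k
    rcases Int.eq_nat_or_neg k with ⟨j, rfl | rfl⟩
    · exact ⟨2 ^ j, 0, by simp⟩
    · exact ⟨1, j, by simp⟩
  constructor
  · intro h
    have h1 := (hpow (-k)).mul (h.add (⟨-m, n, rfl⟩ : IsDyadic (((-m : ℤ) : ℝ) / 2 ^ n)))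
    have h2 : (2 : ℝ) ^ (-k) * ((2 : ℝ) ^ k * t + m / 2 ^ n + ((-m : ℤ) : ℝ) / 2 ^ n) = t := by
      push_cast
      rw [neg_div, add_neg_cancel_right, ← mul_assoc, ← zpow_add₀ two_ne_zero, neg_add_cancel,
        zpow_zero, one_mul]
    rwa [h2] at h1
  · intro h
    exact ((hpow k).mul h).add ⟨m, n, rfl⟩

/-- Gluing criterion for the membership of explicit maps in `F`: away from a finite set of dyadic
points the map is locally given by `2 ^ k * s + m / 2 ^ n`, and everywhere it takes such a value. -/
theorem mem_F_of_pieces (f : unitInterval ≃ₜ unitInterval) (hf : StrictMono f)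
    (hd : ∀ t : unitInterval, ∃ (k m : ℤ) (n : ℕ), (f t : ℝ) = (2 : ℝ) ^ k * t + m / 2 ^ n)
    (S : Set unitInterval) (hS : S.Finite) (hSd : ∀ t ∈ S, IsDyadic (t : ℝ))
    (hloc : ∀ t, t ∉ S → ∃ (k : ℤ) (b : ℝ), ∀ᶠ s : unitInterval in 𝓝 t,
      (f s : ℝ) = (2 : ℝ) ^ k * s + b) : f ∈ F := by
  refine ⟨hf, fun t => ?_, S, hS, hSd, fun t ht => ?_⟩
  · obtain ⟨k, m, n, h⟩ := hd t
    rw [h, isDyadic_affine_iff]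
  · obtain ⟨k, b, h⟩ := hloc t ht
    refine ⟨k, ?_⟩
    have h0 := h.self_of_nhds
    filter_upwards [h] with s hs
    rw [hs, h0]
    ring

theorem eventually_coe_lt {t : unitInterval} {a : ℝ} (h : (t : ℝ) < a) :
    ∀ᶠ s : unitInterval in 𝓝 t, (s : ℝ) < a :=
  continuous_subtype_val.continuousAt.eventually (gt_mem_nhds h)

theorem eventually_lt_coe {t : unitInterval} {a : ℝ} (h : a < (t : ℝ)) :
    ∀ᶠ s : unitInterval in 𝓝 t, a < (s : ℝ) :=
  continuous_subtype_val.continuousAt.eventually (lt_mem_nhds h)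

theorem x₀Homeo_mem_F : x₀Homeo ∈ F := by
  have hval : ∀ t : unitInterval, (x₀Homeo t : ℝ) = x₀Fun t := fun t => rfl
  refine mem_F_of_pieces _ (fun s t hst => ?_) (fun t => ?_)
    {t | (t : ℝ) ∈ ({1 / 2, 3 / 4} : Set ℝ)} ?_ ?_ ?_
  · have hst' : (s : ℝ) < t := hst
    change x₀Fun s < x₀Fun t
    unfold x₀Fun
    split_ifs <;> linarith
  · rw [hval]
    unfold x₀Fun
    split_ifs
    · exact ⟨-1, 0, 0, by norm_num; ring⟩
    · exact ⟨0, -1, 2, by norm_num; ring⟩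
    · exact ⟨1, -1, 0, by norm_num; ring⟩
  · exact (Set.toFinite ({1 / 2, 3 / 4} : Set ℝ)).preimage Subtype.val_injective.injOn
  · rintro t (h | h)
    · exact ⟨1, 1, by rw [h]; norm_num⟩
    · exact ⟨3, 2, by rw [Set.mem_singleton_iff.1 h]; norm_num⟩
  · intro t ht
    simp only [Set.mem_ofPred_eq, Set.mem_insert_iff, Set.mem_singleton_iff, not_or] at ht
    obtain ⟨n1, n2⟩ := ht
    rcases lt_or_gt_of_ne n1 with h1 | h1
    · refine ⟨-1, 0, ?_⟩
      filter_upwards [eventually_coe_lt h1] with s hs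
      rw [hval, x₀Fun, if_pos hs.le]
      norm_num
      ring
    rcases lt_or_gt_of_ne n2 with h2 | h2
    · refine ⟨0, -1 / 4, ?_⟩
      filter_upwards [eventually_lt_coe h1, eventually_coe_lt h2] with s hs1 hs2
      rw [hval, x₀Fun, if_neg hs1.not_ge, if_pos hs2.le]
      norm_num
      ring
    · refine ⟨1, -1, ?_⟩
      filter_upwards [eventually_lt_coe h1, eventually_lt_coe h2] with s hs1 hs2
      rw [hval, x₀Fun, if_neg hs1.not_ge, if_neg hs2.not_ge]
      norm_num
      ring

theorem x₁Homeo_mem_F : x₁Homeo ∈ F := by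
  have hval : ∀ t : unitInterval, (x₁Homeo t : ℝ) = x₁Fun t := fun t => rfl
  refine mem_F_of_pieces _ (fun s t hst => ?_) (fun t => ?_)
    {t | (t : ℝ) ∈ ({1 / 2, 3 / 4, 7 / 8} : Set ℝ)} ?_ ?_ ?_
  · have hst' : (s : ℝ) < t := hst
    change x₁Fun s < x₁Fun t
    unfold x₁Fun
    split_ifs <;> linarith
  · rw [hval]
    unfold x₁Fun
    split_ifs
    · exact ⟨0, 0, 0, by norm_num⟩
    · exact ⟨-1, 1, 2, by norm_num; ring⟩
    · exact ⟨0, -1, 3, by norm_num; ring⟩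
    · exact ⟨1, -1, 0, by norm_num; ring⟩
  · exact (Set.toFinite ({1 / 2, 3 / 4, 7 / 8} : Set ℝ)).preimage Subtype.val_injective.injOn
  · rintro t (h | h | h)
    · exact ⟨1, 1, by rw [h]; norm_num⟩
    · exact ⟨3, 2, by rw [h]; norm_num⟩
    · exact ⟨7, 3, by rw [Set.mem_singleton_iff.1 h]; norm_num⟩
  · intro t ht
    simp only [Set.mem_ofPred_eq, Set.mem_insert_iff, Set.mem_singleton_iff, not_or] at ht
    obtain ⟨n1, n2, n3⟩ := ht
    rcases lt_or_gt_of_ne n1 with h1 | h1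
    · refine ⟨0, 0, ?_⟩
      filter_upwards [eventually_coe_lt h1] with s hs
      rw [hval, x₁Fun, if_pos hs.le]
      norm_num
    rcases lt_or_gt_of_ne n2 with h2 | h2
    · refine ⟨-1, 1 / 4, ?_⟩
      filter_upwards [eventually_lt_coe h1, eventually_coe_lt h2] with s hs1 hs2
      rw [hval, x₁Fun, if_neg hs1.not_ge, if_pos hs2.le]
      norm_num
      ring
    rcases lt_or_gt_of_ne n3 with h3 | h3
    · refine ⟨0, -1 / 8, ?_⟩
      filter_upwards [eventually_lt_coe h1, eventually_lt_coe h2, eventually_coe_lt h3]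
        with s hs1 hs2 hs3
      rw [hval, x₁Fun, if_neg hs1.not_ge, if_neg hs2.not_ge, if_pos hs3.le]
      norm_num
      ring
    · refine ⟨1, -1, ?_⟩
      filter_upwards [eventually_lt_coe h1, eventually_lt_coe h2, eventually_lt_coe h3]
        with s hs1 hs2 hs3
      rw [hval, x₁Fun, if_neg hs1.not_ge, if_neg hs2.not_ge, if_neg hs3.not_ge]
      norm_num
      ring

/-- The generator `x₀` of `F`. -/
def x₀ : F := ⟨x₀Homeo, x₀Homeo_mem_F⟩

/-- The generator `x₁` of `F`. -/
def x₁ : F := ⟨x₁Homeo, x₁Homeo_mem_F⟩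

/-- The formula for `c₁` on `[0, 1)`, with values in `[0, 1]`. -/
def c₁Fun (t : ℝ) : ℝ :=
  if t < 1 / 2 then t / 2 + 3 / 4 else if t < 3 / 4 then 2 * t - 1 else t - 1 / 4

/-- The map of the circle given by `c₁Fun`. -/
def c₁Circle : UnitAddCircle → UnitAddCircle :=
  AddCircle.liftIco 1 0 fun t : ℝ => (c₁Fun t : UnitAddCircle)

theorem c₁Circle_coe {t : ℝ} (h0 : 0 ≤ t) (h1 : t < 1) :
    c₁Circle (t : UnitAddCircle) = (c₁Fun t : UnitAddCircle) := by
  rw [c₁Circle, AddCircle.liftIco_zero_coe_apply ⟨h0, h1⟩]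

/-- The rotation of the circle by one half of a turn. -/
def halfTurn : UnitAddCircle ≃ₜ UnitAddCircle := Homeomorph.addRight ((1 / 2 : ℝ) : UnitAddCircle)

theorem halfTurn_mem_T : halfTurn ∈ T := by
  have hval : ∀ x, halfTurn x = x + ((1 / 2 : ℝ) : UnitAddCircle) := fun x => rfl
  refine ⟨⟨OrderIso.addRight (1 / 2), fun x => ?_, fun x => ?_⟩, fun x => ?_, ∅, Set.finite_empty,
    by simp, fun x _ => ⟨0, Filter.Eventually.of_forall fun h => ?_⟩⟩
  · change x + 1 + 1 / 2 = x + 1 / 2 + 1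
    ring
  · rw [hval, ← AddCircle.coe_add]
    rfl
  · obtain ⟨t, -, rfl⟩ := exists_coe_eq x
    rw [hval, ← AddCircle.coe_add, isDyadicPt_coe, isDyadicPt_coe]
    have := isDyadic_affine_iff 0 1 1 t
    simpa using this
  · rw [hval, hval, zpow_zero, one_mul]
    abel

theorem x₀_c₁Circle (x : UnitAddCircle) : (inclusion x₀).1 (c₁Circle x) = halfTurn x := by
  obtain ⟨t, ht1, rfl⟩ := exists_coe_eq x
  have ht0 := t.2.1
  have hval : ∀ s : ℝ, ∀ hs : s ∈ Set.Icc (0 : ℝ) 1,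
      (inclusion x₀).1 (s : UnitAddCircle) = (x₀Fun s : UnitAddCircle) :=
    fun s hs => inclusion_apply x₀ ⟨s, hs⟩
  rw [c₁Circle_coe ht0 ht1, hval]
  · change _ = ((t : ℝ) : UnitAddCircle) + ((1 / 2 : ℝ) : UnitAddCircle)
    rw [← AddCircle.coe_add]
    unfold c₁Fun x₀Fun
    have key : ∀ a b : ℝ, (a = b ∨ a = b - 1) → (a : UnitAddCircle) = (b : UnitAddCircle) := by
      rintro a b (rfl | rfl)
      · rfl
      · have := coe_intCast_add (-1) b
        rw [← this]
        congr 1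
        push_cast
        ring
    apply key
    split_ifs <;> first | (left; linarith) | (right; linarith)
  · unfold c₁Fun
    constructor <;> split_ifs <;> linarith

/-- The generator `c₁` of `T`: the homeomorphism of the circle that is given by `c₁Fun` on
`[0, 1)`. -/
def c₁ : T where
  val :=
    { toFun := c₁Circle
      invFun := fun x => halfTurn.symm ((inclusion x₀).1 x)
      left_inv := fun x => by
        change halfTurn.symm ((inclusion x₀).1 (c₁Circle x)) = x
        rw [x₀_c₁Circle, halfTurn.symm_apply_apply]
      right_inv := fun x => by
        apply (inclusion x₀).1.injective
        rw [x₀_c₁Circle, halfTurn.apply_symm_apply]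
      continuous_toFun := by
        have h : c₁Circle = fun x => (inclusion x₀).1.symm (halfTurn x) := by
          funext x
          rw [← x₀_c₁Circle, Homeomorph.symm_apply_apply]
        rw [h]
        exact (inclusion x₀).1.symm.continuous.comp halfTurn.continuous
      continuous_invFun := halfTurn.symm.continuous.comp (inclusion x₀).1.continuous }
  property := by
    convert T.mul_mem (T.inv_mem (inclusion x₀).2) halfTurn_mem_T using 1
    ext x
    change c₁Circle x = (inclusion x₀).1.symm (halfTurn x)
    rw [← x₀_c₁Circle, Homeomorph.symm_apply_apply]

end Thompson

end

noncomputable section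

namespace Thompson

/-! ## Word length -/

section WordLength

variable {G : Type*} [Group G] {S : Set G}

/-! Word length in both groups is compared with one combinatorial quantity: the number of standard
dyadic intervals, at all levels, that `g` does not map affinely onto standard dyadic intervals (`bad
g`). This number is finite (`finite_bad`) and subadditive under composition (`ncard_bad_mul_le`), so
on `T` it is at most a constant times the word length for any finite generating set.

Conversely, suppose that `g` fixes the base point of the circle. The set `bad g` is closed under
prefixes, so it is avoided by the leaves of a binary tree `A` with at most `(bad g).ncard + 1`
leaves. Since `g` preserves the order on `[0, 1]`, the images of these leaves are again the leaves
of a tree `B` (`exists_treeMaps`). The generators `x₀` and `x₁` act on tree shapes as rotations at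
the root and at its right child. Linearly many such rotations bring any tree to a shape that depends
only on its number of leaves (`reach_canonical`), so a word of linear length takes `A` to `B`; that
word represents `g`, because a pair of trees determines the element (`TreeMaps.unique`).

Thus the length in `F` is at most linear in the number of bad intervals, which is at most linear in
the length in `T`; this is the lower estimate. The upper estimate is the Lipschitz property of a
homomorphism between finitely generated groups. The same construction shows that `x₀` and `x₁`
generate `F`. For `T` it then remains to see that `x₀` and `c₁` already move every dyadic point to
the base point. -/

theorem wordLength_le_of_list {l : List G} (hl : ∀ a ∈ l, a ∈ S ∨ a⁻¹ ∈ S) :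
    wordLength S l.prod ≤ l.length :=
  Nat.sInf_le ⟨l, hl, rfl, rfl⟩

theorem exists_list_of_mem_closure {g : G} (hg : g ∈ Subgroup.closure S) :
    ∃ l : List G, (∀ a ∈ l, a ∈ S ∨ a⁻¹ ∈ S) ∧ l.prod = g := by
  rw [← Subgroup.mem_toSubmonoid, Subgroup.closure_toSubmonoid] at hg
  obtain ⟨l, hl, h⟩ := Submonoid.exists_list_of_mem_closure hg
  exact ⟨l, fun a ha => by simpa using hl a ha, h⟩

/-- Generation makes the set of lengths nonempty, so the infimum is attained and is not the default
value `0`. -/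
theorem exists_list_length_eq_wordLength (hS : Subgroup.closure S = ⊤) (g : G) :
    ∃ l : List G, (∀ a ∈ l, a ∈ S ∨ a⁻¹ ∈ S) ∧ l.prod = g ∧ l.length = wordLength S g := by
  obtain ⟨l, hl, h⟩ := exists_list_of_mem_closure (hS ▸ Subgroup.mem_top g : g ∈ _)
  exact Nat.sInf_mem (s := {n : ℕ | ∃ l : List G, (∀ a ∈ l, a ∈ S ∨ a⁻¹ ∈ S) ∧ l.prod = g ∧
    l.length = n}) ⟨_, l, hl, h, rfl⟩

theorem wordLength_one : wordLength S (1 : G) = 0 :=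
  Nat.le_zero.1 (wordLength_le_of_list (S := S) (l := []) (by simp))

theorem wordLength_mul_le (hS : Subgroup.closure S = ⊤) (g h : G) :
    wordLength S (g * h) ≤ wordLength S g + wordLength S h := by
  obtain ⟨l, hl, rfl, e⟩ := exists_list_length_eq_wordLength hS g
  obtain ⟨m, hm, rfl, e'⟩ := exists_list_length_eq_wordLength hS h
  rw [← e, ← e', ← List.prod_append, ← List.length_append]
  refine wordLength_le_of_list fun a ha => ?_
  rcases List.mem_append.1 ha with ha | ha
  · exact hl a ha
  · exact hm a ha

/-- A subadditive function on a finitely generated group is bounded by a multiple of the word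
length. -/
theorem exists_le_mul_wordLength (hfin : S.Finite) (hS : Subgroup.closure S = ⊤) (ℓ : G → ℕ)
    (h1 : ℓ 1 = 0) (hmul : ∀ g h, ℓ (g * h) ≤ ℓ g + ℓ h) :
    ∃ K : ℕ, ∀ g, ℓ g ≤ K * wordLength S g := by
  -- `ℓ` need not be invariant under inversion, so the bound is taken over the generators and their
  -- inverses.
  obtain ⟨K, hK⟩ := ((hfin.union hfin.inv).image ℓ).bddAbove
  refine ⟨K, fun g => ?_⟩
  obtain ⟨l, hl, rfl, e⟩ := exists_list_length_eq_wordLength hS g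
  rw [← e]
  clear e
  induction l with
  | nil => simp [h1]
  | cons a l ih =>
    have ha : ℓ a ≤ K := hK ⟨a, by simpa using hl a (by simp), rfl⟩
    have := ih fun b hb => hl b (by simp [hb])
    rw [List.prod_cons, List.length_cons]
    calc _ ≤ _ := hmul _ _
      _ ≤ K + K * l.length := by omega
      _ = _ := by ring

end WordLength

/-! ## Standard dyadic intervals -/

/-- The increasing affine map from `[0, 1]` onto the standard dyadic interval with address `w`,
where `false` stands for the left half and `true` for the right half. -/
def cell : List Bool → ℝ → ℝ
  | [], s => s
  | b :: w, s => ((if b then 1 else 0) + cell w s) / 2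

theorem cell_append (w u : List Bool) (s : ℝ) : cell (w ++ u) s = cell w (cell u s) := by
  induction w with
  | nil => rfl
  | cons b w ih => simp [cell, ih]

theorem strictMono_cell (w : List Bool) : StrictMono (cell w) := by
  induction w with
  | nil => exact strictMono_id
  | cons b w ih =>
    intro s t h
    have := ih h
    simp only [cell]
    linarith

theorem cell_zero_nonneg (w : List Bool) : 0 ≤ cell w 0 := by
  induction w with
  | nil => exact le_rfl
  | cons b w ih =>
    simp only [cell]
    split_ifs <;> linarith

theorem cell_one_le_one (w : List Bool) : cell w 1 ≤ 1 := by
  induction w with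
  | nil => exact le_rfl
  | cons b w ih =>
    simp only [cell]
    split_ifs <;> linarith

theorem cell_nonneg (w : List Bool) {s : ℝ} (hs : 0 ≤ s) : 0 ≤ cell w s :=
  (cell_zero_nonneg w).trans ((strictMono_cell w).monotone hs)

theorem cell_le_one (w : List Bool) {s : ℝ} (hs : s ≤ 1) : cell w s ≤ 1 :=
  ((strictMono_cell w).monotone hs).trans (cell_one_le_one w)

theorem cell_pos (w : List Bool) {s : ℝ} (hs : 0 < s) : 0 < cell w s :=
  (cell_zero_nonneg w).trans_lt (strictMono_cell w hs)

theorem cell_lt_one (w : List Bool) {s : ℝ} (hs : s < 1) : cell w s < 1 :=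
  (strictMono_cell w hs).trans_le (cell_one_le_one w)

theorem cell_mem (w : List Bool) {s : ℝ} (hs : s ∈ Set.Icc (0 : ℝ) 1) :
    cell w s ∈ Set.Icc (0 : ℝ) 1 :=
  ⟨cell_nonneg w hs.1, cell_le_one w hs.2⟩

/-- The numerator is the integer with binary digits `w`; this and its converse `exists_div_eq_cell`
translate addresses into dyadic arithmetic. -/
theorem exists_cell_eq_div (w : List Bool) :
    ∃ i : ℕ, i < 2 ^ w.length ∧ ∀ s, cell w s = (i + s) / 2 ^ w.length := by
  induction w with
  | nil => exact ⟨0, by simp, fun s => by simp [cell]⟩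
  | cons b w ih =>
    obtain ⟨i, hi, h⟩ := ih
    cases b
    · refine ⟨i, by simp only [List.length_cons, pow_succ]; omega, fun s => ?_⟩
      simp only [cell, h, List.length_cons]
      field_simp
      simp
      ring
    · refine ⟨i + 2 ^ w.length, by simp only [List.length_cons, pow_succ]; omega, fun s => ?_⟩
      simp only [cell, h, List.length_cons]
      push_cast
      field_simp
      ring

theorem exists_div_eq_cell (m j : ℕ) (hj : j < 2 ^ m) :
    ∃ w : List Bool, ∀ s, cell w s = (j + s) / 2 ^ m := by
  induction m generalizing j with
  | zero =>
    obtain rfl : j = 0 := by simpa using hj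
    exact ⟨[], fun s => by simp [cell]⟩
  | succ m ih =>
    rw [pow_succ] at hj
    by_cases h : j < 2 ^ m
    · obtain ⟨w, hw⟩ := ih j h
      refine ⟨false :: w, fun s => ?_⟩
      simp only [cell, hw]
      field_simp
      simp
      ring
    · obtain ⟨w, hw⟩ := ih (j - 2 ^ m) (by omega)
      refine ⟨true :: w, fun s => ?_⟩
      simp only [cell, hw]
      rw [Nat.cast_sub (by omega)]
      push_cast
      field_simp
      ring

/-- The image of the midpoint lies strictly inside one half of `[0, 1]`, which reveals the first
letter; the rest follows by induction. A nonempty address never gives the identity, since its image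
lies in one half. -/
theorem eq_of_cell_eqOn {w v : List Bool} (h : ∀ s ∈ Set.Ioo (0 : ℝ) 1, cell w s = cell v s) :
    w = v := by
  have key : ∀ (b : Bool) (u : List Bool),
      ¬ ∀ s ∈ Set.Ioo (0 : ℝ) 1, cell (b :: u) s = s := by
    intro b u hu
    have h1 := hu (1 / 4) (by norm_num)
    have h2 := hu (3 / 4) (by norm_num)
    have h3 := cell_pos u (s := 1 / 4) (by norm_num)
    have h4 := cell_lt_one u (s := 3 / 4) (by norm_num)
    simp only [cell] at h1 h2
    split_ifs at h1 h2 <;> linarith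
  induction w generalizing v with
  | nil =>
    cases v with
    | nil => rfl
    | cons b v => exact (key b v fun s hs => (h s hs).symm).elim
  | cons b w ih =>
    cases v with
    | nil => exact (key b w h).elim
    | cons c v =>
      have hbc : b = c := by
        have h1 := h (1 / 2) (by norm_num)
        have h2 := cell_pos w (s := 1 / 2) (by norm_num)
        have h3 := cell_pos v (s := 1 / 2) (by norm_num)
        have h4 := cell_lt_one w (s := 1 / 2) (by norm_num)
        have h5 := cell_lt_one v (s := 1 / 2) (by norm_num)
        simp only [cell] at h1
        cases b <;> cases c <;> simp at h1 ⊢ <;> linarith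
      subst hbc
      rw [ih fun s hs => ?_]
      have := h s hs
      simp only [cell] at this
      linarith

/-! ## Standard dyadic intervals that are mapped to standard dyadic intervals -/

/-- `g` maps the standard dyadic interval `w` affinely onto the standard dyadic interval `v`. -/
def Maps (g : T) (w v : List Bool) : Prop :=
  ∀ s ∈ Set.Icc (0 : ℝ) 1, g.1 (cell w s : UnitAddCircle) = (cell v s : UnitAddCircle)

theorem Maps.append {g : T} {w v : List Bool} (h : Maps g w v) (u : List Bool) :
    Maps g (w ++ u) (v ++ u) := fun s hs => by
  rw [cell_append, cell_append, h _ (cell_mem u hs)]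

theorem Maps.mul {g h : T} {w v u : List Bool} (hh : Maps h w v) (hg : Maps g v u) :
    Maps (g * h) w u := fun s hs => by
  change g.1 (h.1 _) = _
  rw [hh s hs, hg s hs]

theorem Maps.inv {g : T} {w v : List Bool} (h : Maps g w v) : Maps g⁻¹ v w := fun s hs => by
  change g.1.symm _ = _
  rw [← h s hs, Homeomorph.symm_apply_apply]

theorem maps_one (w : List Bool) : Maps 1 w w := fun _ _ => rfl

theorem eq_of_coe_eq {x y : ℝ} (h : (x : UnitAddCircle) = y) (h1 : x < y + 1) (h2 : y < x + 1) :
    x = y := by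
  rw [← sub_eq_zero, ← AddCircle.coe_sub, AddCircle.coe_eq_zero_iff] at h
  obtain ⟨n, hn⟩ := h
  simp only [zsmul_eq_mul, mul_one] at hn
  have h3 : (n : ℝ) < 1 := by linarith
  have h4 : (-1 : ℝ) < n := by linarith
  have h5 : n < 1 := by exact_mod_cast h3
  have h6 : -1 < n := by exact_mod_cast h4
  obtain rfl : n = 0 := by omega
  simp at hn
  linarith

/-- Interior points of intervals lie in `(0, 1)`, where the projection to the circle is injective;
hence only open intervals are compared. This makes the injection in `ncard_bad_mul_le` possible. -/
theorem Maps.eq_of_eq {g : T} {w w' v : List Bool} (h : Maps g w v) (h' : Maps g w' v) :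
    w = w' := by
  refine eq_of_cell_eqOn fun s hs => ?_
  have hs' := Set.Ioo_subset_Icc_self hs
  have h0 := cell_pos w hs.1
  have h1 := cell_pos w' hs.1
  have h2 := cell_lt_one w hs.2
  have h3 := cell_lt_one w' hs.2
  exact eq_of_coe_eq (g.1.injective ((h s hs').trans (h' s hs').symm)) (by linarith) (by linarith)

/-- The addresses of the standard dyadic intervals that `g` does not map affinely onto standard
dyadic intervals. -/
def bad (g : T) : Set (List Bool) := {w | ¬ ∃ v, Maps g w v}

/-- Closure under prefixes is what allows the bad addresses to be avoided by the leaves of a small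
tree. -/
theorem mem_bad_of_append {g : T} {w u : List Bool} (h : w ++ u ∈ bad g) : w ∈ bad g :=
  fun ⟨_, hv⟩ => h ⟨_, hv.append u⟩

theorem bad_one : bad 1 = ∅ :=
  Set.eq_empty_of_forall_notMem fun w hw => hw ⟨w, maps_one w⟩

/-- If `w` is bad for `g * h` but not for `h`, then `h` carries it to a standard interval that is
bad for `g`, and that image determines `w`. -/
theorem ncard_bad_mul_le {g h : T} (hg : (bad g).Finite) (hh : (bad h).Finite) :
    (bad (g * h)).ncard ≤ (bad g).ncard + (bad h).ncard := by
  have hex : ∀ w : List Bool, ∃ v, w ∉ bad h → Maps h w v := by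
    intro w
    by_cases hw : w ∈ bad h
    -- A default value: `im` matters only off `bad h`.
    · exact ⟨[], fun h' => (h' hw).elim⟩
    · obtain ⟨v, hv⟩ := not_not.1 hw
      exact ⟨v, fun _ => hv⟩
  choose im him using hex
  have hinj : Set.InjOn im (bad (g * h) \ bad h) := fun w hw w' hw' e =>
    (him w hw.2).eq_of_eq (e ▸ him w' hw'.2)
  have hsub : im '' (bad (g * h) \ bad h) ⊆ bad g := by
    rintro _ ⟨w, hw, rfl⟩ ⟨u, hu⟩
    exact hw.1 ⟨u, (him w hw.2).mul hu⟩
  have h1 : (bad (g * h) \ bad h).ncard ≤ (bad g).ncard := by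
    rw [← hinj.ncard_image]
    exact Set.ncard_le_ncard hsub hg
  have h2 := Set.ncard_le_ncard_sdiff_add_ncard (bad (g * h)) (bad h) hh
  omega

/-! ## An element of `T` has finitely many bad intervals -/

/-- The derivative is locally constant on a connected open interval, hence constant, and its value
at the midpoint is a power of two. Continuity extends the formula to the endpoints. -/
theorem eq_affine_of_locally_affine {f : ℝ → ℝ} (hf : Continuous f) {a b : ℝ} (hab : a < b)
    (h : ∀ t ∈ Set.Ioo a b, ∃ k : ℤ, ∀ᶠ e in 𝓝 (0 : ℝ), f (t + e) = f t + (2 : ℝ) ^ k * e) :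
    ∃ k : ℤ, ∀ t ∈ Set.Icc a b, f t = f a + (2 : ℝ) ^ k * (t - a) := by
  have hev : ∀ t ∈ Set.Ioo a b, ∃ k : ℤ, ∀ᶠ y in 𝓝 t, f y = f t + (2 : ℝ) ^ k * (y - t) := by
    intro t ht
    obtain ⟨k, hk⟩ := h t ht
    have hlim : Filter.Tendsto (fun y : ℝ => y - t) (𝓝 t) (𝓝 0) := by
      have : Continuous fun y : ℝ => y - t := by fun_prop
      simpa using this.tendsto t
    refine ⟨k, ?_⟩
    filter_upwards [hlim.eventually hk] with y hy
    simpa using hy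
  have haff : ∀ (k : ℤ) (c t y : ℝ), HasDerivAt (fun y => c + (2 : ℝ) ^ k * (y - t)) (2 ^ k) y := by
    intro k c t y
    simpa using (((hasDerivAt_id y).sub_const t).const_mul ((2 : ℝ) ^ k)).const_add c
  have hder : ∀ t ∈ Set.Ioo a b, ∃ k : ℤ, deriv f =ᶠ[𝓝 t] fun _ => (2 : ℝ) ^ k := by
    intro t ht
    obtain ⟨k, hk⟩ := hev t ht
    have hk' : f =ᶠ[𝓝 t] fun y => f t + (2 : ℝ) ^ k * (y - t) := hk
    refine ⟨k, hk'.deriv.trans (Filter.Eventually.of_forall fun y => (haff k _ t y).deriv)⟩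
  have hmid : (a + b) / 2 ∈ Set.Ioo a b := ⟨by linarith, by linarith⟩
  obtain ⟨k, hk⟩ := hder _ hmid
  have hconst : ∀ t ∈ Set.Ioo a b, deriv f t = (2 : ℝ) ^ k := by
    intro t ht
    rw [← show deriv f _ = (2 : ℝ) ^ k from hk.self_of_nhds]
    -- Applied to `deriv f` itself, whose derivative vanishes because it is locally constant.
    refine isOpen_Ioo.is_const_of_deriv_eq_zero isPreconnected_Ioo (fun y hy => ?_) (fun y hy => ?_)
      ht hmid
    · obtain ⟨l, hl⟩ := hder y hy
      exact (hl.differentiableAt_iff.2 (differentiableAt_const _)).differentiableWithinAt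
    · obtain ⟨l, hl⟩ := hder y hy
      rw [hl.deriv_eq]
      simp
  have hdiff : DifferentiableOn ℝ f (Set.Ioo a b) := by
    intro y hy
    obtain ⟨l, hl⟩ := hev y hy
    have hl' : f =ᶠ[𝓝 y] fun z => f y + (2 : ℝ) ^ l * (z - y) := hl
    exact (hl'.differentiableAt_iff.2 (haff l _ y y).differentiableAt).differentiableWithinAt
  obtain ⟨c, hc⟩ := isOpen_Ioo.exists_eq_add_of_deriv_eq isPreconnected_Ioo hdiff
    (g := fun y => 0 + (2 : ℝ) ^ k * (y - a))
    (fun y _ => (haff k 0 a y).differentiableAt.differentiableWithinAt)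
    (fun y hy => by rw [hconst y hy, (haff k 0 a y).deriv])
  have hcl := hc.closure hf (by fun_prop)
  rw [closure_Ioo hab.ne] at hcl
  refine ⟨k, fun t ht => ?_⟩
  have h1 := hcl ht
  have h2 := hcl (Set.left_mem_Icc.2 hab.le)
  simp only at h1 h2
  rw [h1, h2]
  ring

/-- Provides a level at which every breakpoint is an endpoint of standard intervals, so that none
lies inside one. -/
theorem exists_common_denominator {S : Set UnitAddCircle} (hS : S.Finite)
    (hd : ∀ x ∈ S, IsDyadicPt x) :
    ∃ N : ℕ, ∀ x ∈ S, ∃ m : ℤ, x = ((m / 2 ^ N : ℝ) : UnitAddCircle) := by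
  have h : ∀ x : UnitAddCircle, ∃ (m : ℤ) (n : ℕ), x ∈ S → x = ((m / 2 ^ n : ℝ) : UnitAddCircle) := by
    intro x
    by_cases hx : x ∈ S
    · obtain ⟨t, ⟨m, n, rfl⟩, rfl⟩ := hd x hx
      exact ⟨m, n, fun _ => rfl⟩
    · exact ⟨0, 0, fun h => (hx h).elim⟩
  choose m n hmn using h
  obtain ⟨N, hN⟩ := (hS.image n).bddAbove
  refine ⟨N, fun x hx => ⟨m x * 2 ^ (N - n x), ?_⟩⟩
  have hle : n x ≤ N := hN ⟨x, hx, rfl⟩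
  conv_lhs => rw [hmn x hx]
  congr 1
  push_cast
  rw [div_eq_div_iff (by positivity) (by positivity), mul_assoc, ← pow_add, Nat.sub_add_cancel hle]

/-- A subinterval of length `2 ^ (-|w| - |u|)` has an image of length `2 ^ (-M)`, where `M = |w| +
|u| - k`. The image is standard modulo `1` as soon as its left endpoint is a multiple of `2 ^ (-M)`,
and this holds once `M` is at least the exponent `p` of the denominator of `φ (cell w 0)`. -/
theorem exists_maps_append_of_affine {g : T} {φ : ℝ → ℝ} {w : List Bool}
    (hφ : ∀ x : ℝ, g.1 (x : UnitAddCircle) = (φ x : UnitAddCircle)) {k : ℤ}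
    (hk : ∀ t ∈ Set.Icc (cell w 0) (cell w 1), φ t = φ (cell w 0) + (2 : ℝ) ^ k * (t - cell w 0))
    (hd : IsDyadic (φ (cell w 0))) :
    ∃ K : ℕ, ∀ u : List Bool, K ≤ u.length → ∃ v, Maps g (w ++ u) v := by
  obtain ⟨m, p, hm⟩ := hd
  refine ⟨p + k.toNat, fun u hu => ?_⟩
  obtain ⟨i, -, hi⟩ := exists_cell_eq_div w
  obtain ⟨j, -, hj⟩ := exists_cell_eq_div u
  obtain ⟨M, hM⟩ : ∃ M : ℕ, (M : ℤ) = w.length + u.length - k :=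
    ⟨(w.length + u.length - k : ℤ).toNat, by omega⟩
  have hpM : p ≤ M := by omega
  -- The image is the interval from `q / 2 ^ M` to `(q + 1) / 2 ^ M` on the line; reducing `q`
  -- modulo `2 ^ M` moves it into `[0, 1]` without changing it on the circle.
  set q : ℤ := m * 2 ^ (M - p) + j with hq
  have hmod0 : 0 ≤ q % 2 ^ M := Int.emod_nonneg _ (by positivity)
  have hmod1 : q % 2 ^ M < 2 ^ M := Int.emod_lt_of_pos _ (by positivity)
  obtain ⟨r, hr⟩ : ∃ r : ℕ, (r : ℤ) = q % 2 ^ M := ⟨(q % 2 ^ M).toNat, by omega⟩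
  obtain ⟨v, hv⟩ := exists_div_eq_cell M r (by rw [← hr] at hmod1; exact_mod_cast hmod1)
  refine ⟨v, fun s hs => ?_⟩
  have hus := cell_mem u hs
  rw [hφ, cell_append, hk _ ⟨(strictMono_cell w).monotone hus.1, (strictMono_cell w).monotone hus.2⟩,
    hv, ← coe_intCast_add (q / 2 ^ M) ((r + s) / 2 ^ M)]
  congr 1
  have hqr : (q : ℝ) = 2 ^ M * (q / 2 ^ M : ℤ) + r := by
    have h1 := Int.mul_ediv_add_emod q (2 ^ M)
    rw [← hr] at h1
    exact_mod_cast h1.symm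
  have hq' : (q : ℝ) = m * 2 ^ (M - p) + j := by
    rw [hq]
    push_cast
    ring
  have hpow : (2 : ℝ) ^ k = 2 ^ w.length * 2 ^ u.length / 2 ^ M := by
    rw [eq_div_iff (by positivity), ← pow_add, ← zpow_natCast, ← zpow_natCast,
      ← zpow_add₀ two_ne_zero]
    congr 1
    push_cast
    omega
  have hMp : (2 : ℝ) ^ M = 2 ^ (M - p) * 2 ^ p := by rw [← pow_add, Nat.sub_add_cancel hpM]
  have h1 : (m : ℝ) / 2 ^ p = m * 2 ^ (M - p) / 2 ^ M := by
    rw [hMp]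
    field_simp
  have h2 : ((q / 2 ^ M : ℤ) : ℝ) = (q - r) / 2 ^ M := by
    rw [hqr]
    field_simp
    ring
  rw [hm, hi, hi, hj, h1, h2, hpow, hq']
  field_simp
  ring

/-- At level `N` the breakpoints are endpoints, so the lift is affine on each interval of that
level, and all sufficiently deep subintervals are good. There are finitely many intervals of level
`N`, so the lengths of the bad addresses are bounded. -/
theorem finite_bad (g : T) : (bad g).Finite := by
  obtain ⟨⟨φ, hφ1, hφ⟩, hgd, S, hS, hSd, hloc⟩ := g.2
  obtain ⟨N, hN⟩ := exists_common_denominator hS hSd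
  have hφc : Continuous φ := φ.continuous
  have hex : ∀ w : List Bool, ∃ K : ℕ, w.length = N →
      ∀ u : List Bool, K ≤ u.length → ∃ v, Maps g (w ++ u) v := by
    intro w
    by_cases hw : w.length = N
    swap
    · exact ⟨0, fun h => (hw h).elim⟩
    obtain ⟨i, -, hi⟩ := exists_cell_eq_div w
    rw [hw] at hi
    have hdy : IsDyadic (φ (cell w 0)) := by
      rw [← isDyadicPt_coe, ← hφ, hgd, isDyadicPt_coe, hi]
      exact ⟨i, N, by simp⟩
    have haff := eq_affine_of_locally_affine hφc (strictMono_cell w zero_lt_one) fun t ht => by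
      have htS : (t : UnitAddCircle) ∉ S := by
        intro h
        obtain ⟨m, hm⟩ := hN _ h
        rw [← sub_eq_zero, ← AddCircle.coe_sub, AddCircle.coe_eq_zero_iff] at hm
        obtain ⟨n, hn⟩ := hm
        simp only [zsmul_eq_mul, mul_one] at hn
        -- A breakpoint in the interior would have a numerator strictly between the consecutive
        -- integers `i` and `i + 1`.
        have ht' : t = ((m + n * 2 ^ N : ℤ) : ℝ) / 2 ^ N := by
          push_cast
          field_simp
          rw [hn]
          field_simp
          ring
        rw [hi, hi, ht', Set.mem_Ioo, div_lt_div_iff_of_pos_right (by positivity),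
          div_lt_div_iff_of_pos_right (by positivity)] at ht
        have h1 : (i : ℤ) < m + n * 2 ^ N := by
          have := ht.1
          rw [add_zero] at this
          exact_mod_cast this
        have h2 : m + n * 2 ^ N < i + 1 := by exact_mod_cast ht.2
        omega
      obtain ⟨k, hk⟩ := hloc _ htS
      refine ⟨k, ?_⟩
      -- The local formula for `g` holds only modulo `1`; near `e = 0` the two sides of the lifted
      -- formula differ by less than `1`, so they agree.
      have hcont : Continuous fun e : ℝ => φ (t + e) - (φ t + (2 : ℝ) ^ k * e) := by fun_prop
      have hlim := hcont.tendsto 0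
      simp only [add_zero, mul_zero, sub_self] at hlim
      filter_upwards [hk, hlim.eventually (gt_mem_nhds (zero_lt_one' ℝ)),
        hlim.eventually (lt_mem_nhds (show (-1 : ℝ) < 0 by norm_num))] with e h1 h2 h3
      refine eq_of_coe_eq ?_ (by linarith) (by linarith)
      rw [← hφ, AddCircle.coe_add, AddCircle.coe_add, ← hφ]
      exact h1
    obtain ⟨k, hk⟩ := haff
    obtain ⟨K, hK⟩ := exists_maps_append_of_affine hφ hk hdy
    exact ⟨K, fun _ => hK⟩
  choose K hK using hex
  obtain ⟨M, hM⟩ := ((List.finite_length_eq Bool N).image K).bddAbove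
  refine (List.finite_length_le Bool (N + M)).subset fun w hw => ?_
  by_contra hlen
  simp only [Set.mem_ofPred_eq, not_le] at hlen
  refine hw ?_
  have hlen' : (w.take N).length = N := by
    rw [List.length_take]
    omega
  have := hK (w.take N) hlen' (w.drop N) ?_
  · rwa [List.take_append_drop] at this
  · rw [List.length_drop]
    have h1 : K (w.take N) ≤ M := hM ⟨_, hlen', rfl⟩
    omega

/-! ## Lifts of the elements of `T` that fix the base point -/

/-- Any lift sends `0` to an integer, which is subtracted. -/
theorem exists_lift_of_map_zero {g : T} (hg : g.1 0 = 0) :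
    ∃ φ : ℝ → ℝ, StrictMono φ ∧ φ 0 = 0 ∧ φ 1 = 1 ∧
      ∀ x : ℝ, g.1 (x : UnitAddCircle) = (φ x : UnitAddCircle) := by
  obtain ⟨⟨φ, hφ1, hφ⟩, -⟩ := g.2
  have h0 := hφ 0
  rw [AddCircle.coe_zero, hg, eq_comm, AddCircle.coe_eq_zero_iff] at h0
  obtain ⟨n, hn⟩ := h0
  simp only [zsmul_eq_mul, mul_one] at hn
  refine ⟨fun x => ((-n : ℤ) : ℝ) + φ x, fun x y h => ?_, ?_, ?_, fun x => ?_⟩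
  · simpa using h
  · push_cast
    linarith
  · have := hφ1 0
    rw [zero_add] at this
    simp only [this]
    push_cast
    linarith
  · rw [hφ, coe_intCast_add]

/-- Both sides lie in `[0, 1]`, so equality modulo `1` could fail to lift only by confusing `0` with
`1`. For `s > 0` neither side is `0`, and for `s = 0` neither side is `1`. -/
theorem Maps.lift {g : T} {φ : ℝ → ℝ} (hmono : StrictMono φ) (h0 : φ 0 = 0) (h1 : φ 1 = 1)
    (hφ : ∀ x : ℝ, g.1 (x : UnitAddCircle) = (φ x : UnitAddCircle)) {w v : List Bool}
    (h : Maps g w v) {s : ℝ} (hs : s ∈ Set.Icc (0 : ℝ) 1) : φ (cell w s) = cell v s := by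
  have hw := cell_mem w hs
  have hv := cell_mem v hs
  have e := h s hs
  rw [hφ] at e
  have l0 := hmono.monotone hw.1
  have l1 := hmono.monotone hw.2
  rw [h0] at l0
  rw [h1] at l1
  rcases hs.1.lt_or_eq with hs0 | hs0
  · have := hmono (cell_pos w hs0)
    rw [h0] at this
    have := cell_pos v hs0
    exact eq_of_coe_eq e (by linarith) (by linarith [hv.2])
  · have := hmono (cell_lt_one w (s := s) (by linarith))
    rw [h1] at this
    have := cell_lt_one v (s := s) (by linarith)
    exact eq_of_coe_eq e (by linarith [hv.1]) (by linarith)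

/-! ## Dyadic subdivisions and binary trees -/

/-- The list `L` of standard dyadic intervals is a subdivision of `[a, b]`, in increasing order. -/
def Tiles : List (List Bool) → ℝ → ℝ → Prop
  | [], a, b => a = b
  | w :: L, a, b => cell w 0 = a ∧ Tiles L (cell w 1) b

theorem Tiles.append {L M : List (List Bool)} {a b c : ℝ} (hL : Tiles L a b) (hM : Tiles M b c) :
    Tiles (L ++ M) a c := by
  induction L generalizing a with
  | nil => exact (show a = b from hL) ▸ hM
  | cons w L ih => exact ⟨hL.1, ih hL.2⟩

theorem Tiles.exists_of_append {L M : List (List Bool)} {a c : ℝ} (h : Tiles (L ++ M) a c) :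
    ∃ b, Tiles L a b ∧ Tiles M b c := by
  induction L generalizing a with
  | nil => exact ⟨a, rfl, h⟩
  | cons w L ih =>
    obtain ⟨b, h1, h2⟩ := ih h.2
    exact ⟨b, ⟨h.1, h1⟩, h2⟩

theorem Tiles.le {L : List (List Bool)} {a b : ℝ} (h : Tiles L a b) : a ≤ b := by
  induction L generalizing a with
  | nil => exact (show a = b from h).le
  | cons w L ih => exact h.1 ▸ (strictMono_cell w zero_lt_one).le.trans (ih h.2)

theorem Tiles.eq_nil {L : List (List Bool)} {a : ℝ} (h : Tiles L a a) : L = [] := by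
  cases L with
  | nil => rfl
  | cons w L =>
    have := strictMono_cell w zero_lt_one
    rw [h.1] at this
    exact (this.not_ge (Tiles.le h.2)).elim

theorem Tiles.map_cons {L : List (List Bool)} {a b : ℝ} (h : Tiles L a b) (c : Bool) :
    Tiles (L.map (List.cons c)) (((if c then 1 else 0) + a) / 2)
      (((if c then 1 else 0) + b) / 2) := by
  induction L generalizing a with
  | nil => exact (show a = b from h) ▸ rfl
  | cons w L ih =>
    refine ⟨?_, ih h.2⟩
    rw [cell, h.1]

/-- The empty address already covers `[0, 1]`, leaving degenerate subdivisions on either side. -/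
theorem Tiles.eq_singleton {L : List (List Bool)} (h : Tiles L 0 1) (hL : [] ∈ L) : L = [[]] := by
  obtain ⟨L₁, L₂, rfl⟩ := List.append_of_mem hL
  obtain ⟨b, h1, h2, h3⟩ := h.exists_of_append
  simp only [cell] at h2 h3
  subst h2
  rw [h1.eq_nil, h3.eq_nil]
  rfl

theorem Tiles.exists_right {L : List (List Bool)} {a b : ℝ} (h : Tiles L a b) (hL : [] ∉ L)
    (ha : 1 / 2 ≤ a) : ∃ M, L = M.map (List.cons true) ∧ Tiles M (2 * a - 1) (2 * b - 1) := by
  induction L generalizing a with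
  | nil => exact ⟨[], rfl, by rw [show a = b from h]; rfl⟩
  | cons w L ih =>
    rw [List.mem_cons, not_or] at hL
    obtain ⟨h1, h2⟩ := h
    cases w with
    | nil => exact (hL.1 rfl).elim
    | cons c w =>
      have hlt := cell_lt_one w zero_lt_one
      cases c
      · simp [cell] at h1
        linarith
      have hw := strictMono_cell (true :: w) zero_lt_one
      obtain ⟨M, rfl, hM⟩ := ih h2 hL.2 (by linarith)
      refine ⟨w :: M, rfl, ?_, ?_⟩
      · simp [cell] at h1
        linarith
      · convert hM using 1
        simp [cell]
        ring

/-- Only the whole interval `[]` has `1 / 2` in its interior, so without it the subdivision splits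
there. This is the recursive step from subdivisions to trees. -/
theorem Tiles.exists_halves {L : List (List Bool)} {a b : ℝ} (h : Tiles L a b) (hL : [] ∉ L)
    (ha : a ≤ 1 / 2) (hb : 1 / 2 ≤ b) :
    ∃ M N, L = M.map (List.cons false) ++ N.map (List.cons true) ∧ Tiles M (2 * a) 1 ∧
      Tiles N 0 (2 * b - 1) := by
  induction L generalizing a with
  | nil =>
    have hab : a = b := h
    refine ⟨[], [], rfl, show 2 * a = 1 by linarith, show 0 = 2 * b - 1 by linarith⟩
  | cons w L ih =>
    have h' := h
    have hL' := hL
    rw [List.mem_cons, not_or] at hL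
    obtain ⟨h1, h2⟩ := h
    cases w with
    | nil => exact (hL.1 rfl).elim
    | cons c w =>
      cases c
      · have hle := cell_one_le_one w
        obtain ⟨M, N, rfl, hM, hN⟩ := ih h2 hL.2 (by simp [cell]; linarith)
        refine ⟨w :: M, N, rfl, ⟨?_, ?_⟩, hN⟩
        · simp [cell] at h1
          linarith
        · convert hM using 1
          simp [cell]
          ring
      · have hge := cell_zero_nonneg w
        have ha' : a = 1 / 2 := by
          simp [cell] at h1
          linarith
        obtain ⟨N, hN, hN'⟩ := Tiles.exists_right h' hL' ha'.ge
        refine ⟨[], N, hN, show 2 * a = 1 by linarith, ?_⟩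
        rw [ha'] at hN'
        norm_num at hN'
        exact hN'

/-- Finite rooted binary trees. -/
inductive BinTree : Type
  | leaf : BinTree
  | node : BinTree → BinTree → BinTree

namespace BinTree

/-- The addresses of the leaves of a binary tree, from left to right. -/
def leaves : BinTree → List (List Bool)
  | leaf => [[]]
  | node A B => A.leaves.map (List.cons false) ++ B.leaves.map (List.cons true)

/-- The number of leaves. -/
def size (A : BinTree) : ℕ := A.leaves.length

theorem size_leaf : leaf.size = 1 := rfl

theorem size_node (A B : BinTree) : (node A B).size = A.size + B.size := by
  simp [size, leaves]

theorem size_pos (A : BinTree) : 0 < A.size := by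
  induction A with
  | leaf => exact Nat.one_pos
  | node A B ihA ihB => rw [size_node]; omega

theorem tiles_leaves (A : BinTree) : Tiles A.leaves 0 1 := by
  induction A with
  | leaf => exact ⟨rfl, rfl⟩
  | node A B ihA ihB =>
    have hA := ihA.map_cons false
    have hB := ihB.map_cons true
    norm_num at hA hB
    exact hA.append hB

theorem exists_mem_leaves (A : BinTree) {t : ℝ} (ht : t ∈ Set.Icc (0 : ℝ) 1) :
    ∃ w ∈ A.leaves, ∃ s ∈ Set.Icc (0 : ℝ) 1, cell w s = t := by
  induction A generalizing t with
  | leaf => exact ⟨[], by simp [leaves], t, ht, rfl⟩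
  | node A B ihA ihB =>
    obtain ⟨h0, h1⟩ := ht
    rcases le_total t (1 / 2) with h | h
    · obtain ⟨w, hw, s, hs, e⟩ := ihA (t := 2 * t) ⟨by linarith, by linarith⟩
      refine ⟨false :: w, by simp [leaves, hw], s, hs, ?_⟩
      simp [cell, e]
    · obtain ⟨w, hw, s, hs, e⟩ := ihB (t := 2 * t - 1) ⟨by linarith, by linarith⟩
      refine ⟨true :: w, by simp [leaves, hw], s, hs, ?_⟩
      simp [cell, e]

end BinTree

open BinTree

/-- A subdivision of `[0, 1]` into standard dyadic intervals is given by a binary tree. -/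
theorem Tiles.exists_leaves_eq {L : List (List Bool)} (h : Tiles L 0 1) :
    ∃ A : BinTree, A.leaves = L := by
  obtain ⟨n, hn⟩ : ∃ n, ∀ w ∈ L, w.length ≤ n := by
    obtain ⟨n, hn⟩ := (L.toFinset.finite_toSet.image List.length).bddAbove
    exact ⟨n, fun w hw => hn ⟨w, by simpa using hw, rfl⟩⟩
  -- Passing to a half removes the first letter of every address, which lowers the bound on the
  -- lengths.
  induction n generalizing L with
  | zero =>
    refine ⟨leaf, (h.eq_singleton ?_).symm⟩
    cases L with
    | nil => exact (zero_ne_one (α := ℝ) h).elim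
    | cons w L =>
      have := hn w (by simp)
      rw [Nat.le_zero, List.length_eq_zero_iff] at this
      simp [this]
  | succ n ih =>
    by_cases hL : [] ∈ L
    · exact ⟨leaf, (h.eq_singleton hL).symm⟩
    obtain ⟨M, N, rfl, hM, hN⟩ := h.exists_halves hL (by norm_num) (by norm_num)
    norm_num at hM hN
    obtain ⟨A, rfl⟩ := ih hM fun w hw => by simpa using hn (false :: w) (by simp [hw])
    obtain ⟨B, rfl⟩ := ih hN fun w hw => by simpa using hn (true :: w) (by simp [hw])
    exact ⟨node A B, rfl⟩

/-- A finite prefix-closed set of words is avoided by the leaves of a tree of the corresponding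
size. -/
theorem exists_tree_of_prefixClosed (B : Finset (List Bool)) (hB : ∀ w u, w ++ u ∈ B → w ∈ B) :
    ∃ A : BinTree, A.size ≤ B.card + 1 ∧ ∀ w ∈ A.leaves, w ∉ B := by
  classical
  induction hn : B.card using Nat.strong_induction_on generalizing B with
  | _ n ih =>
    by_cases hnil : [] ∈ B
    swap
    · exact ⟨leaf, by simp [size_leaf], by simpa [leaves] using hnil⟩
    let C (c : Bool) : Finset (List Bool) := B.preimage (List.cons c) (by simp)
    have hC : ∀ c w, w ∈ C c ↔ c :: w ∈ B := fun c w => Finset.mem_preimage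
    -- The `1` counts the root, so the two trees obtained by induction have at most `B.card + 1`
    -- leaves together.
    have hcard : (C false).card + (C true).card + 1 ≤ B.card := by
      rw [← Finset.card_image_of_injective (C false) (List.cons_injective (a := false)),
        ← Finset.card_image_of_injective (C true) (List.cons_injective (a := true)),
        ← Finset.card_union_of_disjoint, ← Finset.card_erase_add_one hnil]
      · refine Nat.succ_le_succ (Finset.card_le_card fun w hw => ?_)
        rw [Finset.mem_union, Finset.mem_image, Finset.mem_image] at hw
        rcases hw with ⟨u, hu, rfl⟩ | ⟨u, hu, rfl⟩
        · exact Finset.mem_erase.2 ⟨by simp, (hC _ _).1 hu⟩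
        · exact Finset.mem_erase.2 ⟨by simp, (hC _ _).1 hu⟩
      · rw [Finset.disjoint_left]
        simp
    have hcl : ∀ c w u, w ++ u ∈ C c → w ∈ C c := fun c w u h => by
      rw [hC] at h ⊢
      exact hB (c :: w) u h
    obtain ⟨A₀, h0, h0'⟩ := ih _ (by omega) (C false) (hcl false) rfl
    obtain ⟨A₁, h1, h1'⟩ := ih _ (by omega) (C true) (hcl true) rfl
    refine ⟨node A₀ A₁, by rw [size_node]; omega, fun w hw => ?_⟩
    simp only [leaves, List.mem_append, List.mem_map] at hw
    rcases hw with ⟨u, hu, rfl⟩ | ⟨u, hu, rfl⟩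
    · exact fun h => h0' u hu ((hC _ _).2 h)
    · exact fun h => h1' u hu ((hC _ _).2 h)

/-! ## Maps between trees -/

/-- `g` maps the subdivision given by `A` to the subdivision given by `B`. -/
def TreeMaps (g : T) (A B : BinTree) : Prop := List.Forall₂ (Maps g) A.leaves B.leaves

theorem TreeMaps.inv {g : T} {A B : BinTree} (h : TreeMaps g A B) : TreeMaps g⁻¹ B A :=
  List.Forall₂.flip (h.imp fun _ _ => Maps.inv)

theorem TreeMaps.mul {g h : T} {A B C : BinTree} (hh : TreeMaps h A B) (hg : TreeMaps g B C) :
    TreeMaps (g * h) A C := by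
  have key : ∀ {L M N : List (List Bool)}, List.Forall₂ (Maps h) L M →
      List.Forall₂ (Maps g) M N → List.Forall₂ (Maps (g * h)) L N := by
    intro L M N h1
    induction h1 generalizing N with
    | nil => rintro ⟨⟩; exact List.Forall₂.nil
    | cons h1 _ ih =>
      rintro (_ | ⟨h2, h3⟩)
      exact List.Forall₂.cons (h1.mul h2) (ih h3)
  exact key hh hg

theorem treeMaps_one (A : BinTree) : TreeMaps 1 A A :=
  List.forall₂_same.2 fun w _ => maps_one w

theorem TreeMaps.size_eq {g : T} {A B : BinTree} (h : TreeMaps g A B) : A.size = B.size :=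
  List.Forall₂.length_eq h

/-- The leaves of `A` cover the circle, and on each of them both maps are the same affine map. -/
theorem TreeMaps.unique {g h : T} {A B : BinTree} (hg : TreeMaps g A B) (hh : TreeMaps h A B) :
    g = h := by
  have key : ∀ {L M : List (List Bool)}, List.Forall₂ (Maps g) L M → List.Forall₂ (Maps h) L M →
      ∀ w ∈ L, ∃ v, Maps g w v ∧ Maps h w v := by
    intro L M h1
    induction h1 with
    | nil => simp
    | @cons w v L M h1 _ ih =>
      rintro (_ | ⟨h2, h3⟩)
      simp only [List.mem_cons, forall_eq_or_imp]
      exact ⟨⟨v, h1, h2⟩, ih h3⟩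
  refine Subtype.ext (Homeomorph.ext fun x => ?_)
  obtain ⟨t, -, rfl⟩ := exists_coe_eq x
  obtain ⟨w, hw, s, hs, hst⟩ := A.exists_mem_leaves t.2
  obtain ⟨v, h1, h2⟩ := key hg hh w hw
  rw [← hst, h1 s hs, h2 s hs]

theorem Maps.forall₂_map {g : T} {w v : List Bool} (h : Maps g w v) (L : List (List Bool)) :
    List.Forall₂ (Maps g) (L.map (w ++ ·)) (L.map (v ++ ·)) := by
  rw [List.forall₂_map_left_iff, List.forall₂_map_right_iff, List.forall₂_same]
  exact fun u _ => h.append u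

/-- An element of `T` that fixes the base point maps some subdivision to some other one. -/
theorem exists_treeMaps {g : T} (hg : g.1 0 = 0) :
    ∃ A B : BinTree, TreeMaps g A B ∧ A.size ≤ (bad g).ncard + 1 := by
  obtain ⟨φ, hmono, h0, h1, hφ⟩ := exists_lift_of_map_zero hg
  obtain ⟨A, hA, hA'⟩ := exists_tree_of_prefixClosed (finite_bad g).toFinset fun w u h => by
    rw [Set.Finite.mem_toFinset] at h ⊢
    exact mem_bad_of_append h
  have hex : ∀ L : List (List Bool), (∀ w ∈ L, w ∉ bad g) → ∃ M, List.Forall₂ (Maps g) L M := by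
    intro L hL
    induction L with
    | nil => exact ⟨[], List.Forall₂.nil⟩
    | cons w L ih =>
      obtain ⟨v, hv⟩ := not_not.1 (hL w (by simp))
      obtain ⟨M, hM⟩ := ih fun u hu => hL u (by simp [hu])
      exact ⟨v :: M, List.Forall₂.cons hv hM⟩
  -- The increasing lift carries adjacent intervals to adjacent ones, so the images of the leaves
  -- again subdivide `[0, 1]` in order and form the leaves of a tree.
  have htiles : ∀ {L M : List (List Bool)}, List.Forall₂ (Maps g) L M → ∀ {a b : ℝ},
      Tiles L a b → Tiles M (φ a) (φ b) := by
    intro L M h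
    induction h with
    | nil => exact fun {a b} h => congrArg φ (show a = b from h)
    | cons h _ ih =>
      rintro a b ⟨rfl, h2⟩
      refine ⟨(h.lift hmono h0 h1 hφ (by norm_num)).symm, ?_⟩
      rw [← h.lift hmono h0 h1 hφ (by norm_num)]
      exact ih h2
  obtain ⟨M, hM⟩ := hex A.leaves fun w hw => by simpa using hA' w hw
  have hM' := htiles hM A.tiles_leaves
  rw [h0, h1] at hM'
  obtain ⟨B, rfl⟩ := hM'.exists_leaves_eq
  refine ⟨A, B, hM, ?_⟩
  rwa [Set.ncard_eq_toFinset_card _ (finite_bad g)]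

/-! ## The generators of `F` as rotations of trees -/

theorem maps_inclusion_of_eqOn {f : F} {w v : List Bool}
    (h : ∀ s (hs : s ∈ Set.Icc (0 : ℝ) 1), (f.1 ⟨cell w s, cell_mem w hs⟩ : ℝ) = cell v s) :
    Maps (inclusion f) w v := fun s hs => by
  rw [← h s hs]
  exact inclusion_apply f ⟨cell w s, cell_mem w hs⟩

theorem maps_x₀ {w v : List Bool} (h : ∀ s ∈ Set.Icc (0 : ℝ) 1, x₀Fun (cell w s) = cell v s) :
    Maps (inclusion x₀) w v := maps_inclusion_of_eqOn h

theorem maps_x₁ {w v : List Bool} (h : ∀ s ∈ Set.Icc (0 : ℝ) 1, x₁Fun (cell w s) = cell v s) :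
    Maps (inclusion x₁) w v := maps_inclusion_of_eqOn h

/-- `x₀` is affine on the intervals `0`, `10` and `11`, with images `00`, `01` and `1`; any subtrees
hung below them are carried along. Hence `x₀` rotates at the root. -/
theorem treeMaps_x₀ (A B C : BinTree) :
    TreeMaps (inclusion x₀) (node A (node B C)) (node (node A B) C) := by
  have h1 : Maps (inclusion x₀) [false] [false, false] := maps_x₀ fun s hs => by
    obtain ⟨h0, h1⟩ := hs
    simp only [cell, x₀Fun]
    split_ifs <;> simp at * <;> linarith
  have h2 : Maps (inclusion x₀) [true, false] [false, true] := maps_x₀ fun s hs => by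
    obtain ⟨h0, h1⟩ := hs
    simp only [cell, x₀Fun]
    split_ifs <;> simp at * <;> linarith
  have h3 : Maps (inclusion x₀) [true, true] [true] := maps_x₀ fun s hs => by
    obtain ⟨h0, h1⟩ := hs
    simp only [cell, x₀Fun]
    split_ifs <;> simp at * <;> linarith
  have h := List.rel_append (List.rel_append (h1.forall₂_map A.leaves) (h2.forall₂_map B.leaves))
    (h3.forall₂_map C.leaves)
  simpa [TreeMaps, leaves, Function.comp_def] using h

/-- The same rotation, performed at the right child of the root. -/
theorem treeMaps_x₁ (A B C D : BinTree) :
    TreeMaps (inclusion x₁) (node A (node B (node C D))) (node A (node (node B C) D)) := by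
  have h0 : Maps (inclusion x₁) [false] [false] := maps_x₁ fun s hs => by
    obtain ⟨h0, h1⟩ := hs
    simp only [cell, x₁Fun]
    split_ifs <;> simp at * <;> linarith
  have h1 : Maps (inclusion x₁) [true, false] [true, false, false] := maps_x₁ fun s hs => by
    obtain ⟨h0, h1⟩ := hs
    simp only [cell, x₁Fun]
    split_ifs <;> simp at * <;> linarith
  have h2 : Maps (inclusion x₁) [true, true, false] [true, false, true] := maps_x₁ fun s hs => by
    obtain ⟨h0, h1⟩ := hs
    simp only [cell, x₁Fun]
    split_ifs <;> simp at * <;> linarith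
  have h3 : Maps (inclusion x₁) [true, true, true] [true, true] := maps_x₁ fun s hs => by
    obtain ⟨h0, h1⟩ := hs
    simp only [cell, x₁Fun]
    split_ifs <;> simp at * <;> linarith
  have h := List.rel_append (List.rel_append (List.rel_append (h0.forall₂_map A.leaves)
    (h1.forall₂_map B.leaves)) (h2.forall₂_map C.leaves)) (h3.forall₂_map D.leaves)
  simpa [TreeMaps, leaves, Function.comp_def] using h

/-! ## Transforming a tree into a canonical one -/

/-- A word of length at most `n` in the generators `x₀` and `x₁` of `F` maps `A` to `B`. -/
def Reach (n : ℕ) (A B : BinTree) : Prop :=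
  ∃ l : List F, (∀ a ∈ l, a ∈ ({x₀, x₁} : Set F) ∨ a⁻¹ ∈ ({x₀, x₁} : Set F)) ∧ l.length ≤ n ∧
    TreeMaps (inclusion l.prod) A B

theorem Reach.trans {m n : ℕ} {A B C : BinTree} (h : Reach m A B) (h' : Reach n B C) :
    Reach (m + n) A C := by
  obtain ⟨l, hl, hlm, hm⟩ := h
  obtain ⟨l', hl', hln, hn⟩ := h'
  -- The second word stands on the left because products are compositions.
  refine ⟨l' ++ l, fun a ha => ?_, by rw [List.length_append]; omega, ?_⟩
  · rcases List.mem_append.1 ha with ha | ha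
    · exact hl' a ha
    · exact hl a ha
  · rw [List.prod_append, map_mul]
    exact hm.mul hn

theorem Reach.symm {n : ℕ} {A B : BinTree} (h : Reach n A B) : Reach n B A := by
  obtain ⟨l, hl, hln, hm⟩ := h
  refine ⟨(l.map fun a => a⁻¹).reverse, fun a ha => ?_, by simpa using hln, ?_⟩
  · simp only [List.mem_reverse, List.mem_map] at ha
    obtain ⟨b, hb, rfl⟩ := ha
    rw [inv_inv]
    exact (hl b hb).symm
  · rw [← List.prod_inv_reverse, map_inv]
    exact hm.inv

theorem Reach.mono {m n : ℕ} {A B : BinTree} (h : Reach m A B) (hmn : m ≤ n) : Reach n A B :=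
  let ⟨l, hl, hlm, hm⟩ := h
  ⟨l, hl, hlm.trans hmn, hm⟩

theorem Reach.refl (A : BinTree) : Reach 0 A A :=
  ⟨[], by simp, le_rfl, by simpa using treeMaps_one A⟩

theorem reach_rotate (A B C : BinTree) : Reach 1 (node A (node B C)) (node (node A B) C) :=
  ⟨[x₀], by simp, le_rfl, by simpa using treeMaps_x₀ A B C⟩

theorem reach_rotate_right (A B C D : BinTree) :
    Reach 1 (node A (node B (node C D))) (node A (node (node B C) D)) :=
  ⟨[x₁], by simp, le_rfl, by simpa using treeMaps_x₁ A B C D⟩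

/-- The tree with `n` leaves added successively to the right of `A`. -/
def addLeaves (A : BinTree) : ℕ → BinTree
  | 0 => A
  | n + 1 => addLeaves (node A leaf) n

theorem addLeaves_addLeaves (A : BinTree) (m n : ℕ) :
    addLeaves (addLeaves A m) n = addLeaves A (m + n) := by
  induction m generalizing A with
  | zero => rw [Nat.zero_add]; rfl
  | succ m ih => rw [Nat.succ_add]; exact ih _

/-- The subtree `A` is dismantled and its leaves are moved one at a time into `L`: an inverse `x₁`
splits each interior node of `A`, and an `x₀` absorbs each leaf. With `n` leaves and `n - 1`
interior nodes this costs `2 * n - 1`. -/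
theorem reach_absorb (L A D : BinTree) :
    Reach (2 * A.size - 1) (node L (node A D)) (node (addLeaves L A.size) D) := by
  induction A generalizing L D with
  | leaf => exact reach_rotate L leaf D
  | node A B ihA ihB =>
    have h := ((reach_rotate_right L A B D).symm.trans (ihA L (node B D))).trans (ihB _ D)
    rw [addLeaves_addLeaves, ← size_node] at h
    refine h.mono ?_
    have := A.size_pos
    have := B.size_pos
    rw [size_node]
    omega

/-- `reach_absorb` is repeated down the right spine of `R`. The last leaf of the spine stays as
right child, hence `R.size - 1`. -/
theorem reach_leaf_right (L R : BinTree) :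
    Reach (2 * R.size) (node L R) (node (addLeaves L (R.size - 1)) leaf) := by
  induction R generalizing L with
  | leaf => exact (Reach.refl _).mono (Nat.zero_le _)
  | node A D _ ihD =>
    have h := (reach_absorb L A D).trans (ihD _)
    have := D.size_pos
    rw [addLeaves_addLeaves, ← Nat.add_sub_assoc this, ← size_node] at h
    refine h.mono ?_
    rw [size_node]
    omega

/-- Inverse rotations at the root shorten the left spine of `L` until a single leaf remains on the
left. -/
theorem reach_leaf_left (L D : BinTree) :
    ∃ R, R.size + 1 = L.size + D.size ∧ Reach L.size (node L D) (node leaf R) := by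
  induction L generalizing D with
  | leaf => exact ⟨D, by rw [size_leaf, Nat.add_comm], (Reach.refl _).mono (Nat.zero_le _)⟩
  | node A B ihA _ =>
    obtain ⟨R, hR, h⟩ := ihA (node B D)
    rw [size_node] at hR
    refine ⟨R, by rw [hR, size_node, Nat.add_assoc], ((reach_rotate A B D).symm.trans h).mono ?_⟩
    have := B.size_pos
    rw [size_node]
    omega

/-- Every tree with at least two leaves is transformed into a tree that depends only on the number
of leaves, by a word of linear length. -/
theorem reach_canonical (A B : BinTree) :
    Reach (3 * (node A B).size) (node A B) (node (addLeaves leaf ((node A B).size - 2)) leaf) := by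
  obtain ⟨R, hR, h⟩ := reach_leaf_left A B
  have h' := h.trans (reach_leaf_right leaf R)
  rw [← size_node] at hR
  rw [show R.size - 1 = (node A B).size - 2 by omega] at h'
  -- The cost is `A.size + 2 * R.size`, where `R` has one leaf fewer than the whole tree.
  refine h'.mono ?_
  rw [size_node] at hR ⊢
  omega

/-- Both trees have the same canonical form; the word for `A` is followed by the reversed word for
`B`, at cost `3 + 3` per leaf. -/
theorem reach_of_size_eq {A B : BinTree} (h : A.size = B.size) : Reach (6 * A.size) A B := by
  cases A with
  | leaf =>
    cases B with
    | leaf => exact (Reach.refl _).mono (Nat.zero_le _)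
    | node B₁ B₂ =>
      rw [size_leaf, size_node] at h
      have := B₁.size_pos
      have := B₂.size_pos
      omega
  | node A₁ A₂ =>
    cases B with
    | leaf =>
      rw [size_leaf, size_node] at h
      have := A₁.size_pos
      have := A₂.size_pos
      omega
    | node B₁ B₂ =>
      have h1 := reach_canonical A₁ A₂
      have h2 := reach_canonical B₁ B₂
      rw [← h] at h2
      exact (h1.trans h2.symm).mono (by omega)

/-- An element of `T` that fixes the base point is the image of a word in `x₀` and `x₁` whose length
is bounded linearly in the number of bad intervals. -/
theorem exists_list_inclusion_prod_eq {g : T} (hg : g.1 0 = 0) :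
    ∃ l : List F, (∀ a ∈ l, a ∈ ({x₀, x₁} : Set F) ∨ a⁻¹ ∈ ({x₀, x₁} : Set F)) ∧
      l.length ≤ 6 * ((bad g).ncard + 1) ∧ inclusion l.prod = g := by
  obtain ⟨A, B, h, hA⟩ := exists_treeMaps hg
  obtain ⟨l, hl, hlen, hm⟩ := reach_of_size_eq h.size_eq
  exact ⟨l, hl, by omega, hm.unique h⟩

/-! ### Generation of `F` and the bound on word length by bad intervals -/

theorem inclusion_map_zero (f : F) : (inclusion f).1 0 = 0 := by
  have := inclusion_apply f 0
  rw [F_map_zero] at this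
  simpa using this

/-- Needed to pull an identity of words in `T` back to `F`. -/
theorem inclusion_injective : Function.Injective inclusion := by
  intro f g h
  refine Subtype.ext (Homeomorph.ext fun t => Subtype.ext ?_)
  have e : ((f.1 t : ℝ) : UnitAddCircle) = (g.1 t : ℝ) := by
    rw [← inclusion_apply, ← inclusion_apply, h]
  rcases eq_or_ne t 1 with rfl | ht
  · rw [F_map_one, F_map_one]
  · have lt : ∀ f : F, (f.1 t : ℝ) < 1 := fun f => by
      have : f.1 t < f.1 1 := f.2.1 (lt_of_le_of_ne t.2.2 ht)
      rwa [F_map_one] at this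
    have := lt f
    have := lt g
    exact eq_of_coe_eq e (by linarith [(g.1 t).2.1]) (by linarith [(f.1 t).2.1])

theorem exists_list_prod_eq (f : F) :
    ∃ l : List F, (∀ a ∈ l, a ∈ ({x₀, x₁} : Set F) ∨ a⁻¹ ∈ ({x₀, x₁} : Set F)) ∧
      l.length ≤ 6 * ((bad (inclusion f)).ncard + 1) ∧ l.prod = f :=
  let ⟨l, hl, hlen, h⟩ := exists_list_inclusion_prod_eq (inclusion_map_zero f)
  ⟨l, hl, hlen, inclusion_injective h⟩

theorem list_prod_mem_closure {G : Type*} [Group G] {S : Set G} {l : List G}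
    (hl : ∀ a ∈ l, a ∈ S ∨ a⁻¹ ∈ S) : l.prod ∈ Subgroup.closure S :=
  Subgroup.list_prod_mem _ fun a ha => (hl a ha).elim (fun h => Subgroup.subset_closure h)
    fun h => (Subgroup.inv_mem_iff _).1 (Subgroup.subset_closure h)

theorem closure_x₀_x₁ : Subgroup.closure ({x₀, x₁} : Set F) = ⊤ :=
  eq_top_iff.2 fun f _ =>
    let ⟨_, hl, _, h⟩ := exists_list_prod_eq f
    h ▸ list_prod_mem_closure hl

theorem wordLength_le_ncard_bad (f : F) :
    wordLength ({x₀, x₁} : Set F) f ≤ 6 * ((bad (inclusion f)).ncard + 1) := by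
  obtain ⟨l, hl, hlen, rfl⟩ := exists_list_prod_eq f
  exact (wordLength_le_of_list hl).trans hlen

/-! ## Generation of `T` -/

theorem mul_c₁_eq_halfTurn : inclusion x₀ * c₁ = ⟨halfTurn, halfTurn_mem_T⟩ :=
  Subtype.ext (Homeomorph.ext x₀_c₁Circle)

theorem inclusion_x₀_inv_apply {t : ℝ} (ht : t ∈ Set.Icc (0 : ℝ) 1) :
    (inclusion x₀)⁻¹.1 (t : UnitAddCircle) = (x₀Inv t : UnitAddCircle) := by
  rw [← map_inv]
  exact inclusion_apply x₀⁻¹ ⟨t, ht⟩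

/-- The half turn `x₀ c₁` brings a dyadic point into `[0, 1 / 2)`. On `[0, 1 / 4]` the inverse of
`x₀` doubles, which lowers the exponent of the denominator; points beyond `1 / 4` are first moved
back by `1 / 4`. -/
theorem exists_mem_map_dyadic_eq_zero {H : Subgroup T} (h0 : inclusion x₀ ∈ H) (h1 : c₁ ∈ H)
    (m : ℤ) (n : ℕ) : ∃ h ∈ H, h.1 ((m / 2 ^ n : ℝ) : UnitAddCircle) = 0 := by
  have hturn : (⟨halfTurn, halfTurn_mem_T⟩ : T) ∈ H := mul_c₁_eq_halfTurn ▸ H.mul_mem h0 h1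
  have hturn' : ∀ t : ℝ, halfTurn (t : UnitAddCircle) = ((t + 1 / 2 : ℝ) : UnitAddCircle) :=
    fun t => rfl
  induction n generalizing m with
  | zero =>
    refine ⟨1, H.one_mem, ?_⟩
    rw [pow_zero, div_one]
    simp
  | succ n ih =>
    have key : ∀ i : ℤ, 0 ≤ i → i < 2 ^ n →
        ∃ h ∈ H, h.1 ((i / 2 ^ (n + 1) : ℝ) : UnitAddCircle) = 0 := by
      intro i hi0 hi1
      have ht0 : (0 : ℝ) ≤ i / 2 ^ (n + 1) := by
        have : (0 : ℝ) ≤ i := by exact_mod_cast hi0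
        positivity
      have ht1 : (i : ℝ) / 2 ^ (n + 1) < 1 / 2 := by
        have : (i : ℝ) < 2 ^ n := by exact_mod_cast hi1
        rw [div_lt_div_iff₀ (by positivity) two_pos, pow_succ]
        linarith
      have hdouble : ∀ j : ℤ, (0 : ℝ) ≤ j / 2 ^ (n + 1) → (j : ℝ) / 2 ^ (n + 1) ≤ 1 / 4 →
          ∃ h ∈ H, h.1 ((j / 2 ^ (n + 1) : ℝ) : UnitAddCircle) = 0 := by
        intro j hj0 hj1
        obtain ⟨h, hH, he⟩ := ih j
        refine ⟨h * (inclusion x₀)⁻¹, H.mul_mem hH (H.inv_mem h0), ?_⟩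
        change h.1 ((inclusion x₀)⁻¹.1 _) = 0
        rw [inclusion_x₀_inv_apply ⟨hj0, by linarith⟩, x₀Inv, if_pos hj1, ← he]
        congr 2
        rw [pow_succ]
        field_simp
      rcases le_or_gt ((i : ℝ) / 2 ^ (n + 1)) (1 / 4) with hle | hgt
      · exact hdouble i ht0 hle
      -- The shift by `1 / 4` keeps the denominator `2 ^ (n + 1)` only if `n ≥ 1`; for `n = 0` the
      -- only numerator is `0`, which is not beyond `1 / 4`.
      cases n with
      | zero =>
        obtain rfl : i = 0 := by
          rw [pow_zero] at hi1
          omega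
        norm_num at hgt
      | succ n =>
        have hshift : ((i - 2 ^ n : ℤ) : ℝ) / 2 ^ (n + 1 + 1) = i / 2 ^ (n + 1 + 1) - 1 / 4 := by
          push_cast
          rw [pow_succ, pow_succ]
          field_simp
          ring
        obtain ⟨h, hH, he⟩ := hdouble (i - 2 ^ n) (by rw [hshift]; linarith)
          (by rw [hshift]; linarith)
        -- On `[1 / 4, 1 / 2]` the inverse of `x₀` adds `1 / 4`; with the half turn this adds `3 /
        -- 4`, which is `-1 / 4` modulo `1`.
        refine ⟨h * (⟨halfTurn, halfTurn_mem_T⟩ * (inclusion x₀)⁻¹),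
          H.mul_mem hH (H.mul_mem hturn (H.inv_mem h0)), ?_⟩
        change h.1 (halfTurn ((inclusion x₀)⁻¹.1 _)) = 0
        rw [inclusion_x₀_inv_apply ⟨ht0, by linarith⟩, x₀Inv, if_neg hgt.not_ge, if_pos ht1.le,
          hturn', ← he, hshift, ← coe_intCast_add 1 (_ - 1 / 4)]
        congr 2
        push_cast
        ring
    have hpos : (0 : ℤ) < 2 ^ (n + 1) := by positivity
    set i := m % 2 ^ (n + 1) with hi
    have hi0 : 0 ≤ i := Int.emod_nonneg _ hpos.ne'
    have hi1 : i < 2 ^ (n + 1) := Int.emod_lt_of_pos _ hpos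
    have hmi : ((m / 2 ^ (n + 1) : ℝ) : UnitAddCircle) = ((i / 2 ^ (n + 1) : ℝ) : UnitAddCircle) := by
      rw [← coe_intCast_add (m / 2 ^ (n + 1)) (i / 2 ^ (n + 1))]
      congr 1
      have h2 : (m : ℝ) = 2 ^ (n + 1) * (m / 2 ^ (n + 1) : ℤ) + i := by
        exact_mod_cast (Int.mul_ediv_add_emod m (2 ^ (n + 1))).symm
      rw [eq_comm, eq_div_iff (by positivity), add_mul, div_mul_cancel₀ _ (by positivity)]
      linarith
    rw [hmi]
    rcases lt_or_ge i (2 ^ n) with hlt | hge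
    · exact key i hi0 hlt
    · rw [pow_succ] at hi1
      obtain ⟨h, hH, he⟩ := key (i - 2 ^ n) (by omega) (by omega)
      refine ⟨h * ⟨halfTurn, halfTurn_mem_T⟩, H.mul_mem hH hturn, ?_⟩
      change h.1 (halfTurn _) = 0
      rw [hturn', ← he, ← coe_intCast_add 1 ((_ : ℤ) / 2 ^ (n + 1) : ℝ)]
      congr 2
      push_cast
      rw [pow_succ]
      field_simp
      ring

theorem closure_x₀_x₁_c₁ :
    Subgroup.closure ({inclusion x₀, inclusion x₁, c₁} : Set T) = ⊤ := by
  set H := Subgroup.closure ({inclusion x₀, inclusion x₁, c₁} : Set T)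
  have h0 : inclusion x₀ ∈ H := Subgroup.subset_closure (by simp)
  have h1 : inclusion x₁ ∈ H := Subgroup.subset_closure (by simp)
  have hc : c₁ ∈ H := Subgroup.subset_closure (by simp)
  have hF : ∀ f : F, inclusion f ∈ H := by
    have : (⊤ : Subgroup F) ≤ H.comap inclusion := by
      rw [← closure_x₀_x₁, Subgroup.closure_le]
      rintro a (rfl | rfl)
      · exact h0
      · exact h1
    exact fun f => this (Subgroup.mem_top f)
  refine eq_top_iff.2 fun g _ => ?_
  -- The image of the base point is dyadic, so some `h ∈ H` moves it back; then `h * g` fixes the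
  -- base point and is the image of an element of `F`.
  obtain ⟨t, ⟨m, n, rfl⟩, ht⟩ := (g.2.2.1 0).2 ⟨0, by simpa using IsDyadic.intCast 0, rfl⟩
  obtain ⟨h, hH, he⟩ := exists_mem_map_dyadic_eq_zero h0 hc m n
  obtain ⟨l, -, -, hl⟩ := exists_list_inclusion_prod_eq (g := h * g) (by
    change h.1 (g.1 0) = 0
    rw [← ht, he])
  exact (H.mul_mem_cancel_left hH).1 (hl ▸ hF l.prod)

/-! ## The quasi-isometric embedding -/

theorem isQuasiIsometricEmbedding_inclusion {A : Set F} {B : Set T} (hA : A.Finite) (hB : B.Finite)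
    (hA' : Subgroup.closure A = ⊤) (hB' : Subgroup.closure B = ⊤) :
    IsQuasiIsometricEmbedding (wordDist A) (wordDist B) inclusion := by
  obtain ⟨K₁, h1⟩ := exists_le_mul_wordLength hA hA' (fun f => wordLength B (inclusion f))
    (by rw [map_one, wordLength_one]) fun f g => by
      rw [map_mul]
      exact wordLength_mul_le hB' _ _
  -- Changing generators from `x₀`, `x₁` to `A` costs the factor `K₂`.
  obtain ⟨K₂, h2⟩ := exists_le_mul_wordLength (Set.toFinite {x₀, x₁}) closure_x₀_x₁ (wordLength A)
    wordLength_one (wordLength_mul_le hA')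
  obtain ⟨K₃, h3⟩ := exists_le_mul_wordLength hB hB' (fun g => (bad g).ncard)
    (by simp [bad_one]) fun g h => ncard_bad_mul_le (finite_bad g) (finite_bad h)
  have hlow : ∀ f : F, wordLength A f ≤ 6 * K₂ * K₃ * wordLength B (inclusion f) + 6 * K₂ := by
    intro f
    calc wordLength A f ≤ K₂ * (6 * ((bad (inclusion f)).ncard + 1)) :=
          (h2 f).trans (Nat.mul_le_mul_left _ (wordLength_le_ncard_bad f))
      _ ≤ K₂ * (6 * (K₃ * wordLength B (inclusion f) + 1)) := by
          have := h3 (inclusion f)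
          gcongr
      _ = _ := by ring
  -- The sum dominates the coefficients of both estimates, and the `1` gives `K ≥ 1`, so that the
  -- additive constant `6 * K₂` still suffices after division by `K`.
  set K : ℝ := K₁ + 6 * K₂ * K₃ + 1 with hK
  have hK1 : 1 ≤ K := by
    have : (0 : ℝ) ≤ K₁ + 6 * K₂ * K₃ := by positivity
    linarith
  have hK0 : 0 < K := by linarith
  refine ⟨K, hK0, 6 * K₂, fun w z => ?_⟩
  have hlow' : (wordLength A (w⁻¹ * z) : ℝ) ≤
      6 * K₂ * K₃ * wordLength B (inclusion (w⁻¹ * z)) + 6 * K₂ := by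
    exact_mod_cast hlow (w⁻¹ * z)
  have hup' : (wordLength B (inclusion (w⁻¹ * z)) : ℝ) ≤ K₁ * wordLength A (w⁻¹ * z) := by
    exact_mod_cast h1 (w⁻¹ * z)
  rw [wordDist, wordDist, ← map_inv, ← map_mul]
  set a : ℝ := Nat.cast (wordLength A (w⁻¹ * z))
  set b : ℝ := Nat.cast (wordLength B (inclusion (w⁻¹ * z)))
  have ha : 0 ≤ a := Nat.cast_nonneg _
  have hb : 0 ≤ b := Nat.cast_nonneg _
  have hC : (0 : ℝ) ≤ 6 * K₂ := by positivity
  have hlow'' : 6 * K₂ * K₃ * b ≤ K * b := mul_le_mul_of_nonneg_right (by rw [hK]; linarith) hb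
  have hup'' : K₁ * a ≤ K * a :=
    mul_le_mul_of_nonneg_right (by rw [hK]; linarith [show (0 : ℝ) ≤ 6 * K₂ * K₃ by positivity]) ha
  have hKC : 6 * (K₂ : ℝ) ≤ K * (6 * K₂) := le_mul_of_one_le_left hC hK1
  refine ⟨?_, by linarith⟩
  rw [sub_le_iff_le_add, one_div_mul_eq_div, div_le_iff₀ hK0]
  linarith

end Thompson

end

theorem corollary4p2 :
    -- the standard generating sets, and the estimate for them
    (Subgroup.closure ({Thompson.x₀, Thompson.x₁} : Set Thompson.F) = ⊤ ∧
      Subgroup.closure ({Thompson.inclusion Thompson.x₀, Thompson.inclusion Thompson.x₁,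
        Thompson.c₁} : Set Thompson.T) = ⊤ ∧
      Thompson.IsQuasiIsometricEmbedding
        (Thompson.wordDist ({Thompson.x₀, Thompson.x₁} : Set Thompson.F))
        (Thompson.wordDist ({Thompson.inclusion Thompson.x₀, Thompson.inclusion Thompson.x₁,
          Thompson.c₁} : Set Thompson.T))
        Thompson.inclusion) ∧
    -- all finite generating sets
    ∀ (A : Set Thompson.F) (B : Set Thompson.T), A.Finite → B.Finite →
      Subgroup.closure A = ⊤ → Subgroup.closure B = ⊤ →
      Thompson.IsQuasiIsometricEmbedding (Thompson.wordDist A) (Thompson.wordDist B)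
        Thompson.inclusion :=
  ⟨⟨Thompson.closure_x₀_x₁, Thompson.closure_x₀_x₁_c₁,
    Thompson.isQuasiIsometricEmbedding_inclusion (Set.toFinite _) (Set.toFinite _)
      Thompson.closure_x₀_x₁ Thompson.closure_x₀_x₁_c₁⟩,
    fun _ _ => Thompson.isQuasiIsometricEmbedding_inclusion⟩
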